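/- **The model.** Let $0<\lambda_1<\lambda_2$, $\theta_1,\theta_2,\kappa\in\mathbb R$, $\sigma_1,\sigma_2>0$, $\rho\in[-1,1]$. In the two-factor Vasicek model the factor process $Z=(Z^1,Z^2)$ solves $dZ^i_t=-\lambda_i(Z^i_t-\theta_i)\,dt+\sigma_i\,dB^i_t$, where $B^1,B^2$ are Brownian motions with $dB^1_t\,dB^2_t=\rho\,dt$, and the short rate is $r_t=\kappa+Z^1_t+Z^2_t$. Conditional on the present state being $z\in\mathbb R^2$ (that is, with $Z$ started from $z$), let $P(x)=\mathbb E\big[\exp(-\int_0^x r_s\,ds)\big]$ be the bond price, $x\mapsto -\partial_x\log P(x)$ the forward curve and $x\mapsto-\frac1x\log P(x)$ the yield curve, and let $E(z)\in\mathbb N\cup\{\infty\}$ be the number of local extrema in $(0,\infty)$ of the curve under consideration (forward or yield). **The lines.** Put $m(x,\lambda)=-\lambda e^{-\lambda x}$, $\gamma(x)=e^{\lambda_1x}$ for the forward curve and $m(x,\lambda)=\frac{e^{-\lambda x}(1+\lambda x)-1}{\lambda x^2}$, $\gamma(x)=1+x^2$ for the yield curve. Let $r=\rho\frac{\sigma_1\sigma_2}{\lambda_1\lambda_2}$,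 $u_i=\theta_i-\frac{\sigma_i^2}{\lambda_i^2}-r$, $b(x)=m(x,\lambda_1)$, $c(x)=m(x,\lambda_2)$, $$a(x)=-\Big\{\tfrac{\sigma_1^2}{2\lambda_1^2}m(x,2\lambda_1)+\tfrac{\sigma_2^2}{2\lambda_2^2}m(x,2\lambda_2)+r\,m(x,\lambda_1+\lambda_2)+u_1m(x,\lambda_1)+u_2m(x,\lambda_2)\Big\},$$ and $F(x,z)=a(x)+b(x)z_1+c(x)z_2$ for $x>0$. For $\delta\in\{0,\infty\}$ let $F(\delta,z)=\lim_{x\to\delta}\gamma(x)F(x,z)$ and $\ell_\delta=\{z:F(\delta,z)=0\}$. Let $Q_h=\{F(0,z)>0>F(\infty,z)\}$ and $Q_d=\{F(0,z)<0<F(\infty,z)\}$. **The envelope.** The envelope $\eta$ is the set of all $z$ for which $F(x,z)=\partial_xF(x,z)=0$ for some $x>0$; it is the curve $\eta(x)=\Big(\frac{W(c,a)(x)}{W(b,c)(x)},\frac{W(a,b)(x)}{W(b,c)(x)}\Big)$, $x\in(0,\infty)$, with $W(f,g)=fg'-gf'$. The augmented envelope $\hat\eta$ with basepoint $M$, where $M$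 is the intersection point of $\ell_0$ and $\ell_\infty$, consists successively of the segment from $M$ to $\eta(0)=\lim_{x\to0}\eta(x)$, the curve $\eta$, and the segment from $\eta(\infty)=\lim_{x\to\infty}\eta(x)$ to $M$; if $\eta(x)$ does not converge as $x\to\delta$, the corresponding segment is replaced by the ray from $M$ in the direction $\lim_{x\to\delta}\eta(x)/|\eta(x)|$. Parametrize the three pieces by $t\in[-1,0)$, $(0,1)$ and $(1,2]$. The winding number $\mathrm{wind}_{\hat\eta}(z)$ is the integer $\frac1{2\pi}(\vartheta(2)-\vartheta(-1))$, where $\vartheta:[-1,2]\to\mathbb R$ is continuous and $\frac{\hat\eta(t)-z}{|\hat\eta(t)-z|}=(\cos\vartheta(t),\sin\vartheta(t))$ for $t\in[-1,2]\setminus\{0,1\}$. **Theorem.** For the forward curve as well as for the yield curve, $\ell_0\cap\ell_\infty$ consists of exactly one point $M$, and for every $z\in\mathbb R^2\setminus(\eta\cup\ell_0\cup\ell_\infty)$ the winding number $\mathrm{wind}_{\hat\eta}(z)$ is well defined (such a $\vartheta$ exists, and the integer does not depend on its choice) and $$E(z)=2\,|\mathrm{wind}_{\hat\eta}(z)|+\mathbf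 1_{Q_h\cup Q_d}(z).$$ -/

import Mathlib

open MeasureTheory ProbabilityTheory Filter Topology
open scoped NNReal

noncomputable section

namespace Vasicek

/-- The Euclidean plane; the coordinates `z₁, z₂` of a state are `z 0, z 1`. -/
abbrev Plane : Type := EuclideanSpace ℝ (Fin 2)

/-! ### The two-factor Vasicek model -/

/-- Admissible parameters of the two-factor Vasicek model
(`lam`, `theta`, `sig` stand for `λ`, `θ`, `σ`; the factors are numbered `0, 1`). -/
structure Params where
  lam : Fin 2 → ℝ
  theta : Fin 2 → ℝ
  sig : Fin 2 → ℝ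
  rho : ℝ
  kappa : ℝ
  lam_pos : 0 < lam 0
  lam_lt : lam 0 < lam 1
  sig_pos : ∀ i, 0 < sig i
  rho_mem : rho ∈ Set.Icc (-1 : ℝ) 1

/-- `B` is a pair of Brownian motions under `Q` with `dB⁰ dB¹ = ρ dt`, and `Z` is the factor
process started from the state `z`: `dZⁱ = -λᵢ (Zⁱ - θᵢ) dt + σᵢ dBⁱ`, `Z₀ = z`, with the
equation written in integrated form (the noise is additive, so `∫₀ᵗ σᵢ dBⁱ = σᵢ Bⁱ_t`).
The time variable is the time elapsed since the present date. -/
structure IsVasicek {Ω : Type*} [MeasurableSpace Ω] (p : Params) (Q : Measure Ω) (z : Plane)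
    (B Z : Fin 2 → ℝ≥0 → Ω → ℝ) : Prop where
  brownian : ∀ i, IsBrownianReal (B i) Q
  jointly_gaussian : IsGaussianProcess (fun (q : Fin 2 × ℝ≥0) ↦ B q.1 q.2) Q
  correlation : ∀ s t : ℝ≥0, cov[B 0 s, B 1 t; Q] = p.rho * (min s t : ℝ≥0)
  continuous_paths : ∀ i, ∀ᵐ ω ∂Q, Continuous (fun t ↦ Z i t ω)
  sde : ∀ i, ∀ᵐ ω ∂Q, ∀ t : ℝ≥0,
    Z i t ω = z i + (∫ s in (0 : ℝ)..t, -p.lam i * (Z i s.toNNReal ω - p.theta i))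
      + p.sig i * B i t ω

section Curves

variable {Ω : Type*} [MeasurableSpace Ω]

/-- The short rate `r_t = κ + Z¹_t + Z²_t`. -/
def shortRate (p : Params) (Z : Fin 2 → ℝ≥0 → Ω → ℝ) (t : ℝ≥0) (ω : Ω) : ℝ :=
  p.kappa + Z 0 t ω + Z 1 t ω

/-- The price `E[exp (-∫₀ˣ r_s ds)]` of the zero-coupon bond with time to maturity `x`, given the
present state from which `Z` is started. -/
def bondPrice (p : Params) (Q : Measure Ω) (Z : Fin 2 → ℝ≥0 → Ω → ℝ) (x : ℝ) : ℝ :=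
  ∫ ω, Real.exp (-∫ s in (0 : ℝ)..x, shortRate p Z s.toNNReal ω) ∂Q

/-- The forward curve `f(x) = -∂ₓ log P(x)`. -/
def forwardCurve (p : Params) (Q : Measure Ω) (Z : Fin 2 → ℝ≥0 → Ω → ℝ) (x : ℝ) : ℝ :=
  -deriv (fun y ↦ Real.log (bondPrice p Q Z y)) x

/-- The yield curve `y(x) = -(1/x) log P(x)`. -/
def yieldCurve (p : Params) (Q : Measure Ω) (Z : Fin 2 → ℝ≥0 → Ω → ℝ) (x : ℝ) : ℝ :=
  -(1 / x) * Real.log (bondPrice p Q Z x)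

/-- The two kinds of term structure curves. -/
inductive CurveKind
  | forward
  | yield

/-- The forward curve or the yield curve, according to the kind. -/
def curve (p : Params) (k : CurveKind) (Q : Measure Ω) (Z : Fin 2 → ℝ≥0 → Ω → ℝ) : ℝ → ℝ :=
  match k with
  | .forward => forwardCurve p Q Z
  | .yield => yieldCurve p Q Z

end Curves

/-- The number of local extrema of a curve defined on `(0, ∞)`. -/
def numLocalExtrema (g : ℝ → ℝ) : ℕ∞ :=
  {x : ℝ | 0 < x ∧ IsLocalExtr g x}.encard

/-! ### Families of lines, limiting lines and quadrants -/

/-- A family of lines `a(x) + b(x) z₁ + c(x) z₂ = 0`, `x ∈ (0, ∞)`, with a positive function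
`scale` by which the coefficients are multiplied before limits at `0` and `∞` are taken. -/
structure LineFamily where
  a : ℝ → ℝ
  b : ℝ → ℝ
  c : ℝ → ℝ
  scale : ℝ → ℝ

namespace LineFamily

variable (L : LineFamily)

/-- `F(x, z) = a(x) + b(x) z₁ + c(x) z₂`. -/
def F (x : ℝ) (z : Plane) : ℝ := L.a x + L.b x * z 0 + L.c x * z 1

/-- The value `F(0, z)`, for the scaled coefficients. -/
def F₀ (z : Plane) : ℝ := limUnder (𝓝[>] (0 : ℝ)) fun x ↦ L.scale x * L.F x z

/-- The value `F(∞, z)`, for the scaled coefficients. -/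
def Finf (z : Plane) : ℝ := limUnder atTop fun x ↦ L.scale x * L.F x z

/-- The limiting line `ℓ₀`. -/
def line₀ : Set Plane := {z | L.F₀ z = 0}

/-- The limiting line `ℓ_∞`. -/
def lineInf : Set Plane := {z | L.Finf z = 0}

/-- The hump-like quadrant `ℓ₀⁺ ∩ ℓ_∞⁻`. -/
def quadrantH : Set Plane := {z | 0 < L.F₀ z ∧ L.Finf z < 0}

/-- The dip-like quadrant `ℓ₀⁻ ∩ ℓ_∞⁺`. -/
def quadrantD : Set Plane := {z | L.F₀ z < 0 ∧ 0 < L.Finf z}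

/-! ### Envelope and augmented envelope -/

/-- The envelope `η`, as a set: all `z` with `F(x, z) = 0` and `∂ₓ F(x, z) = 0` for some
`x ∈ (0, ∞)`. -/
def envelope : Set Plane :=
  {z | ∃ x : ℝ, 0 < x ∧ L.F x z = 0 ∧ deriv (fun y ↦ L.F y z) x = 0}

/-- The Wronskian determinant of two functions. -/
def wronskian (f g : ℝ → ℝ) (x : ℝ) : ℝ := f x * deriv g x - g x * deriv f x

/-- The envelope as a parametrized curve `x ↦ η(x)`: the solution by Cramer's rule of the linear
system `b z₁ + c z₂ = -a`, `b' z₁ + c' z₂ = -a'`. -/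
def eta (x : ℝ) : Plane :=
  !₂[wronskian L.c L.a x / wronskian L.b L.c x, wronskian L.a L.b x / wronskian L.b L.c x]

/-- Where `W(b, c) ≠ 0`, the point `eta x` is the unique solution of the system defining the
envelope. -/
theorem eq_eta_iff (x : ℝ) (z : Plane) (ha : DifferentiableAt ℝ L.a x)
    (hb : DifferentiableAt ℝ L.b x) (hc : DifferentiableAt ℝ L.c x)
    (hW : wronskian L.b L.c x ≠ 0) :
    z = L.eta x ↔ L.F x z = 0 ∧ deriv (fun y ↦ L.F y z) x = 0 := by
  have hd : deriv (fun y ↦ L.F y z) x = deriv L.a x + deriv L.b x * z 0 + deriv L.c x * z 1 :=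
    ((ha.hasDerivAt.add (hb.hasDerivAt.mul_const (z 0))).add (hc.hasDerivAt.mul_const (z 1))).deriv
  rw [hd]
  constructor
  · rintro rfl
    simp only [eta, F, PiLp.toLp_apply, Matrix.cons_val_zero, Matrix.cons_val_one]
    constructor <;> field_simp <;> simp only [wronskian] <;> ring
  · rintro ⟨h1, h2⟩
    ext i
    simp only [F] at h1
    fin_cases i
    · change z 0 = wronskian L.c L.a x / wronskian L.b L.c x
      rw [eq_div_iff hW]
      simp only [wronskian]
      linear_combination (deriv L.c x) * h1 - L.c x * h2
    · change z 1 = wronskian L.a L.b x / wronskian L.b L.c x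
      rw [eq_div_iff hW]
      simp only [wronskian]
      linear_combination (-deriv L.b x) * h1 + L.b x * h2

open Classical in
/-- Part of the limiting line between `M` and the (possibly asymptotic) contact point of `η` as `x`
tends to the end `l` of `(0, ∞)`, parametrized by `s ∈ [0, 1)` and starting from `M` at `s = 0`.
If `η` converges along `l`, this is the segment from `M` to the limit. Otherwise it is the ray from
`M` in the direction in which `η` escapes to infinity. -/
def connect (M : Plane) (l : Filter ℝ) (s : ℝ) : Plane :=
  if ∃ e : Plane, Tendsto L.eta l (𝓝 e) then
    AffineMap.lineMap M (limUnder l L.eta) s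
  else
    M + (s / (1 - s)) • limUnder l (fun x ↦ ‖L.eta x‖⁻¹ • L.eta x)

/-- The augmented envelope with basepoint `M`, parametrized by `t ∈ [-1, 0) ∪ (0, 1) ∪ (1, 2]`:
from `M` along `ℓ₀` to `η(0)`, then along `η`, then from `η(∞)` along `ℓ_∞` back to `M`. -/
def augmentedEnvelope (M : Plane) (t : ℝ) : Plane :=
  if t < 0 then L.connect M (𝓝[>] (0 : ℝ)) (t + 1)
  else if t < 1 then L.eta (t / (1 - t))
  else L.connect M atTop (2 - t)

end LineFamily

/-- `w` is the winding number around `z` of the curve `γ` parametrized by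
`t ∈ [-1, 0) ∪ (0, 1) ∪ (1, 2]`: the position map `t ↦ (γ(t) - z) / |γ(t) - z|` is well defined, is
of the form `(cos θ(t), sin θ(t))` with `θ` continuous on all of `[-1, 2]`, and
`θ(2) - θ(-1) = 2 π w`. -/
def HasWindingNumber (γ : ℝ → Plane) (z : Plane) (w : ℤ) : Prop :=
  ∃ θ : ℝ → ℝ, ContinuousOn θ (Set.Icc (-1) 2) ∧
    (∀ t ∈ Set.Icc (-1 : ℝ) 2, t ≠ 0 → t ≠ 1 →
      γ t ≠ z ∧ ‖γ t - z‖⁻¹ • (γ t - z) = !₂[Real.cos (θ t), Real.sin (θ t)]) ∧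
    θ 2 - θ (-1) = 2 * Real.pi * w

/-! ### The families of lines of the Vasicek model -/

namespace Params

variable (p : Params)

/-- The coefficient `r = ρ σ₁ σ₂ / (λ₁ λ₂)`. -/
def r : ℝ := p.rho * (p.sig 0 * p.sig 1 / (p.lam 0 * p.lam 1))

/-- The coefficients `uᵢ = θᵢ - σᵢ² / λᵢ² - ρ σ₁ σ₂ / (λ₁ λ₂)`. -/
def u (i : Fin 2) : ℝ := p.theta i - p.sig i ^ 2 / p.lam i ^ 2 - p.r

/-- The operator `𝒜`, applied to `m(x, λ)`. -/
def opA (m : ℝ → ℝ → ℝ) (x : ℝ) : ℝ :=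
  -(p.sig 0 ^ 2 / (2 * p.lam 0 ^ 2) * m x (2 * p.lam 0)
    + p.sig 1 ^ 2 / (2 * p.lam 1 ^ 2) * m x (2 * p.lam 1)
    + p.r * m x (p.lam 0 + p.lam 1)
    + p.u 0 * m x (p.lam 0) + p.u 1 * m x (p.lam 1))

/-- `m_f(x, λ) = -λ e^{-λ x}`. -/
def mForward (x l : ℝ) : ℝ := -l * Real.exp (-l * x)

/-- `m_y(x, λ) = (e^{-λ x} (1 + λ x) - 1) / (λ x²)`. -/
def mYield (x l : ℝ) : ℝ := (Real.exp (-l * x) * (1 + l * x) - 1) / (l * x ^ 2)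

/-- The family of lines of the forward curve or of the yield curve: for `x > 0`, the line `ℓ_x`
consists of the states `z` such that `x` is a critical point of the curve given `z`. -/
def family : CurveKind → LineFamily
  | .forward =>
    { a := p.opA mForward
      b := fun x ↦ mForward x (p.lam 0)
      c := fun x ↦ mForward x (p.lam 1)
      scale := fun x ↦ Real.exp (p.lam 0 * x) }
  | .yield =>
    { a := p.opA mYield
      b := fun x ↦ mYield x (p.lam 0)
      c := fun x ↦ mYield x (p.lam 1)
      scale := fun x ↦ 1 + x ^ 2 }

end Params

end Vasicek

end

/-! The price is explicit. The integrated short rate is Gaussian, so `log P` is minus its mean plus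
half its variance, and differentiating shows that the derivative of either curve at `x` is `F(x,
z)`. Off the envelope every zero of `F(·, z)` is simple, so the local extrema are exactly these
zeros (`IsVasicek.hasDerivAt_curve`, `IsVasicek.numLocalExtrema_curve`).

The zeros are counted by comparing two angles. Let `θ(t)` be the angle of the augmented envelope
seen from `z`, and `α(t)` the angle of the normal of the line `ℓ_x`, which is `arctan (c / b)`.
Since `η(x)` lies on `ℓ_x` and `b < 0`, the cosine of `ψ = θ - α` is a positive multiple of `F(x,
z)`, so zeros of `F` are passages of `ψ` through the levels `(k + 1/2)π`. Because `W(b, c) < 0`, the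
lines turn clockwise, which makes every such passage upward (`sin_sub_arctan_mul_neg`). Hence each
level is met at most once and the number of zeros is the number of levels between the end values of
`ψ`.

Over `[-1, 2]` the angle `θ` gains `2πw` and `-α` gains some `D` in `(0, π)`, so the number of
levels is `2w + ε` with `ε ∈ {0, 1}`. It is nonnegative, so `w ≥ 0`. Its parity is read from the
signs of `F` at the two ends: `ε = 1` exactly on the two quadrants
(`encard_cos_zeros_eq_two_mul_natAbs`, `LineFamily.exists_windingNumber`). If the envelope escapes
at infinity, `cos ψ` vanishes at `t = 1` although `F` keeps its sign nearby; there `ψ` touches a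
level and returns (`cosCell_eq_of_cos_pos`).

What remains for each kernel is that the lines turn clockwise, that their scaled coefficients
converge at both ends, and that the envelope converges or, for the forward curve at infinity,
possibly escapes along the limiting line. -/

namespace Vasicek

/-! ### Counting the zeros of `cos ∘ ψ` for a continuous angle `ψ`. -/

section Crossing

variable {ψ : ℝ → ℝ} {a b : ℝ}

/-- A continuous function that passes through the level `c` only from below to above stays above
`c` once it has reached it. -/
theorem lt_of_upcrossing {c : ℝ} (hψ : ContinuousOn ψ (Set.Icc a b)) (ha : ψ a ≠ c) (hb : ψ b ≠ c)
    (hcr : ∀ t ∈ Set.Ioo a b, ψ t = c →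
      (∀ᶠ s in 𝓝[>] t, c < ψ s) ∧ ∀ᶠ s in 𝓝[<] t, ψ s < c)
    {t s : ℝ} (hat : a ≤ t) (hts : t < s) (hsb : s ≤ b) (ht : c ≤ ψ t) : c < ψ s := by
  -- Otherwise let `u` be the last time before `s` with `ψ ≥ c`. Then `ψ u = c`, and the upward
  -- passage at `u` contradicts `ψ < c` just after `u`.
  have key : ∀ s, t < s → s ≤ b → c ≤ ψ s := by
    intro s hts hsb
    by_contra! hlt
    have hcont : ContinuousOn ψ (Set.Icc t s) := hψ.mono (Set.Icc_subset_Icc hat hsb)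
    have hcl : IsClosed (Set.Icc t s ∩ ψ ⁻¹' Set.Ici c) :=
      hcont.preimage_isClosed_of_isClosed isClosed_Icc isClosed_Ici
    have hne : (Set.Icc t s ∩ ψ ⁻¹' Set.Ici c).Nonempty := ⟨t, ⟨le_rfl, hts.le⟩, ht⟩
    have hbd : BddAbove (Set.Icc t s ∩ ψ ⁻¹' Set.Ici c) := ⟨s, fun x hx ↦ hx.1.2⟩
    obtain ⟨⟨htu, hus⟩, hcu⟩ := hcl.csSup_mem hne hbd
    set u := sSup (Set.Icc t s ∩ ψ ⁻¹' Set.Ici c) with hu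
    have hcu' : c ≤ ψ u := hcu
    have hus' : u < s := lt_of_le_of_ne hus fun h ↦ by rw [h] at hcu'; linarith
    have hafter : ∀ v, u < v → v ≤ s → ψ v < c := by
      intro v huv hvs
      by_contra! hv
      exact absurd (le_csSup hbd ⟨⟨htu.trans huv.le, hvs⟩, hv⟩) (not_le.2 huv)
    have hψu : ψ u = c := by
      refine le_antisymm ?_ hcu'
      have h1 : Tendsto ψ (𝓝[Set.Ioo u s] u) (𝓝 (ψ u)) :=
        (hcont u ⟨htu, hus⟩).mono_left
          (nhdsWithin_mono _ fun v hv ↦ ⟨htu.trans hv.1.le, hv.2.le⟩)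
      have : (𝓝[Set.Ioo u s] u).NeBot := by
        rw [nhdsWithin_Ioo_eq_nhdsGT hus']; infer_instance
      refine le_of_tendsto h1 ?_
      filter_upwards [self_mem_nhdsWithin] with v hv
      exact (hafter v hv.1 hv.2.le).le
    have hua : a < u := lt_of_le_of_ne (hat.trans htu) fun h ↦ ha (h ▸ hψu)
    have h1 := (hcr u ⟨hua, hus'.trans_le hsb⟩ hψu).1
    obtain ⟨v, hv1, hv2⟩ := (h1.and (Ioo_mem_nhdsGT hus')).exists
    linarith [hafter v hv2.1 hv2.2.le]
  -- Equality at `s` would be an upward passage, hence values below `c` just before `s`.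
  refine lt_of_le_of_ne (key s hts hsb) fun h ↦ ?_
  have hsb' : s < b := lt_of_le_of_ne hsb fun h' ↦ hb (h' ▸ h.symm)
  have h1 := (hcr s ⟨hat.trans_lt hts, hsb'⟩ h.symm).2
  obtain ⟨v, hv1, hv2⟩ := (h1.and (Ioo_mem_nhdsLT hts)).exists
  linarith [key v hv2.1 (hv2.2.le.trans hsb)]

/-- The index of the interval between consecutive zeros of `cos` that contains `x`. -/
noncomputable def cosCell (x : ℝ) : ℤ := ⌊x / Real.pi - 1 / 2⌋

theorem cos_eq_zero_iff_int {x : ℝ} : Real.cos x = 0 ↔ ∃ k : ℤ, x = (k + 1 / 2) * Real.pi := by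
  rw [Real.cos_eq_zero_iff]
  refine exists_congr fun k ↦ ?_
  constructor <;> intro h <;> rw [h] <;> ring

theorem cosCell_lt_iff {x : ℝ} {k : ℤ} : cosCell x < k ↔ x < (k + 1 / 2) * Real.pi := by
  rw [cosCell, Int.floor_lt, sub_lt_iff_lt_add, div_lt_iff₀ Real.pi_pos]

/-- Cells contain their lower end point, so a zero of `cos` carries the number of the cell that an
upward passage enters. -/
theorem cosCell_level (k : ℤ) : cosCell ((k + 1 / 2) * Real.pi) = k := by
  rw [cosCell, mul_div_assoc, div_self Real.pi_ne_zero]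
  simp

theorem le_cosCell_iff {x : ℝ} (hx : Real.cos x ≠ 0) {k : ℤ} :
    k ≤ cosCell x ↔ (k + 1 / 2) * Real.pi < x := by
  rw [← not_lt, cosCell_lt_iff, not_lt]
  refine ⟨fun h ↦ lt_of_le_of_ne h fun h' ↦ hx (cos_eq_zero_iff_int.2 ⟨k, h'.symm⟩), le_of_lt⟩

/-- Cell `0` starts at `π / 2`, where `cos` becomes negative; hence the sign `-r`. -/
theorem cos_eq_neg_one_zpow_mul {x : ℝ} (hx : Real.cos x ≠ 0) :
    ∃ r : ℝ, 0 < r ∧ Real.cos x = (-1) ^ cosCell x * -r := by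
  have h1 : (cosCell x + 1 / 2) * Real.pi < x := (le_cosCell_iff hx).1 le_rfl
  have h2 : x < ((cosCell x + 1 : ℤ) + 1 / 2) * Real.pi := cosCell_lt_iff.1 (lt_add_one _)
  push_cast at h2
  refine ⟨Real.sin (x - (cosCell x + 1 / 2) * Real.pi),
    Real.sin_pos_of_pos_of_lt_pi (by linarith) (by linarith), ?_⟩
  rw [← Real.cos_add_pi_div_two, ← Real.cos_add_int_mul_pi]
  congr 1
  ring

theorem cos_mul_cos_neg_iff {x y : ℝ} (hx : Real.cos x ≠ 0) (hy : Real.cos y ≠ 0) :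
    Real.cos x * Real.cos y < 0 ↔ Odd (cosCell y - cosCell x) := by
  obtain ⟨r, hr, hxr⟩ := cos_eq_neg_one_zpow_mul hx
  obtain ⟨q, hq, hyq⟩ := cos_eq_neg_one_zpow_mul hy
  have hrq : 0 < r * q := mul_pos hr hq
  have h : Real.cos x * Real.cos y = (-1) ^ (cosCell y - cosCell x) * (r * q) := by
    have h2 : ((-1 : ℝ) ^ cosCell x) = ((-1 : ℝ) ^ cosCell x)⁻¹ := by
      rcases Int.even_or_odd (cosCell x) with h | h
      · simp [h.neg_one_zpow]
      · simp [h.neg_one_zpow]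
    rw [hxr, hyq, zpow_sub₀ (by norm_num), div_eq_mul_inv, ← h2]
    ring
  rw [h]
  rcases Int.even_or_odd (cosCell y - cosCell x) with h | h
  · rw [h.neg_one_zpow, one_mul]
    exact ⟨fun h' ↦ absurd h' (not_lt.2 hrq.le), fun h' ↦ absurd h (Int.not_even_iff_odd.2 h')⟩
  · rw [h.neg_one_zpow]
    exact ⟨fun _ ↦ h, fun _ ↦ by linarith⟩

/-- If `ψ` passes through the zeros of `cos` from below to above only, then the number of zeros of
`cos ∘ ψ` is the difference of the cells that contain the end points. -/
theorem encard_cos_zeros (hab : a < b) (hψ : ContinuousOn ψ (Set.Icc a b))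
    (ha : Real.cos (ψ a) ≠ 0) (hb : Real.cos (ψ b) ≠ 0)
    (hcr : ∀ t ∈ Set.Ioo a b, Real.cos (ψ t) = 0 →
      (∀ᶠ s in 𝓝[>] t, ψ t < ψ s) ∧ ∀ᶠ s in 𝓝[<] t, ψ s < ψ t) :
    cosCell (ψ a) ≤ cosCell (ψ b) ∧
      {t | t ∈ Set.Ioo a b ∧ Real.cos (ψ t) = 0}.encard =
        ((cosCell (ψ b) - cosCell (ψ a)).toNat : ℕ∞) := by
  have hne : ∀ (k : ℤ) (x : ℝ), Real.cos x ≠ 0 → x ≠ (k + 1 / 2) * Real.pi :=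
    fun k x hx h ↦ hx (cos_eq_zero_iff_int.2 ⟨k, h⟩)
  have up : ∀ (k : ℤ) {t s : ℝ}, a ≤ t → t < s → s ≤ b → (k + 1 / 2) * Real.pi ≤ ψ t →
      (k + 1 / 2) * Real.pi < ψ s := by
    intro k t s h1 h2 h3 h4
    refine lt_of_upcrossing hψ (hne k _ ha) (hne k _ hb) (fun u hu huc ↦ ?_) h1 h2 h3 h4
    have := hcr u hu (cos_eq_zero_iff_int.2 ⟨k, huc⟩)
    rwa [huc] at this
  refine ⟨(le_cosCell_iff hb).2 (up _ le_rfl hab le_rfl ((le_cosCell_iff ha).1 le_rfl).le), ?_⟩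
  -- The cell number labels the zeros: every level between the end values is reached by the
  -- intermediate value theorem, no level outside is, and `up` allows each level only one visit.
  have himg : (fun t ↦ cosCell (ψ t)) '' {t | t ∈ Set.Ioo a b ∧ Real.cos (ψ t) = 0} =
      Set.Ioc (cosCell (ψ a)) (cosCell (ψ b)) := by
    ext k
    constructor
    · rintro ⟨t, ⟨ht, hct⟩, rfl⟩
      obtain ⟨k, hk⟩ := cos_eq_zero_iff_int.1 hct
      simp only [hk, cosCell_level]
      refine ⟨cosCell_lt_iff.2 ?_, (le_cosCell_iff hb).2 (up k ht.1.le ht.2 le_rfl hk.ge)⟩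
      by_contra! h
      exact absurd hk (up k le_rfl ht.1 ht.2.le h).ne'
    · rintro ⟨h1, h2⟩
      rw [cosCell_lt_iff] at h1
      rw [le_cosCell_iff hb] at h2
      obtain ⟨t, ht, hk⟩ := intermediate_value_Ioo hab.le hψ ⟨h1, h2⟩
      exact ⟨t, ⟨ht, cos_eq_zero_iff_int.2 ⟨k, hk⟩⟩, by simp only [hk, cosCell_level]⟩
  have hinj : Set.InjOn (fun t ↦ cosCell (ψ t)) {t | t ∈ Set.Ioo a b ∧ Real.cos (ψ t) = 0} := by
    rintro t ⟨ht, hct⟩ s ⟨hs, hcs⟩ hts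
    obtain ⟨k, hk⟩ := cos_eq_zero_iff_int.1 hct
    obtain ⟨l, hl⟩ := cos_eq_zero_iff_int.1 hcs
    simp only [hk, hl, cosCell_level] at hts
    subst hts
    rcases lt_trichotomy t s with h | h | h
    · exact absurd hl (up k ht.1.le h hs.2.le hk.ge).ne'
    · exact h
    · exact absurd hk (up k hs.1.le h ht.2.le hl.ge).ne'
  rw [← hinj.encard_image, himg, ← Finset.coe_Ioc, Set.encard_coe_eq_coe_finsetCard, Int.card_Ioc]

/-- `cos ∘ ψ` passes through a zero with the sign opposite to that of `sin ∘ ψ` when `ψ`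
increases. -/
theorem eventually_lt_of_sin_mul_cos {t : ℝ} {l : Filter ℝ} (hψ : Tendsto ψ l (𝓝 (ψ t)))
    (ht : Real.cos (ψ t) = 0) (h : ∀ᶠ s in l, Real.sin (ψ t) * Real.cos (ψ s) < 0) :
    ∀ᶠ s in l, ψ t < ψ s := by
  have h1 : ∀ᶠ s in l, ψ s ∈ Set.Ioo (ψ t - 1) (ψ t + 1) :=
    hψ.eventually (Ioo_mem_nhds (by linarith) (by linarith))
  filter_upwards [h, h1] with s hs hs1
  by_contra! hle
  -- Where `cos (ψ t) = 0` only one term of the addition formula is left. The increment is smaller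
  -- than `1 < π`, so its sine has its sign.
  have h2 : Real.cos (ψ s) = -(Real.sin (ψ t) * Real.sin (ψ s - ψ t)) := by
    have : ψ s = ψ t + (ψ s - ψ t) := by ring
    rw [this, Real.cos_add, ht]; ring_nf
  have h3 : 0 ≤ Real.sin (ψ t - ψ s) :=
    Real.sin_nonneg_of_nonneg_of_le_pi (by linarith) (by linarith [hs1.1, Real.pi_gt_three])
  rw [← neg_sub, Real.sin_neg] at h3
  rw [h2] at hs
  nlinarith [mul_nonneg (mul_self_nonneg (Real.sin (ψ t))) h3]

theorem eventually_gt_of_sin_mul_cos {t : ℝ} {l : Filter ℝ} (hψ : Tendsto ψ l (𝓝 (ψ t)))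
    (ht : Real.cos (ψ t) = 0) (h : ∀ᶠ s in l, 0 < Real.sin (ψ t) * Real.cos (ψ s)) :
    ∀ᶠ s in l, ψ s < ψ t := by
  have := eventually_lt_of_sin_mul_cos (ψ := fun s ↦ -ψ s) hψ.neg (by simpa using ht)
    (by simpa using h)
  simpa using this

/-- If `cos ∘ ψ` has the same sign on both sides of an exceptional point `m`, then the end points
lie in the same cell, even if `cos (ψ m) = 0`. -/
theorem cosCell_eq_of_cos_pos {m : ℝ} (ham : a < m) (hmb : m < b)
    (hψ : ContinuousOn ψ (Set.Icc a b))
    (h : ∀ t ∈ Set.Icc a b, t ≠ m → 0 < Real.cos (ψ t) * Real.cos (ψ b)) :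
    cosCell (ψ a) = cosCell (ψ b) := by
  have hne : ∀ t ∈ Set.Icc a b, t ≠ m → Real.cos (ψ t) ≠ 0 := fun t ht htm h0 ↦ by
    have := h t ht htm
    rw [h0] at this
    simp at this
  have ha := hne a ⟨le_rfl, (ham.trans hmb).le⟩ ham.ne
  have hb := hne b ⟨(ham.trans hmb).le, le_rfl⟩ hmb.ne'
  have hmc : ContinuousWithinAt ψ (Set.Icc a b) m := hψ m ⟨ham.le, hmb.le⟩
  -- the level of an exceptional zero is on the same side of both end points
  have key : ∀ k : ℤ, (ψ a < (k + 1 / 2) * Real.pi ↔ ψ b < (k + 1 / 2) * Real.pi) := by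
    intro k
    set c := (k + 1 / 2 : ℝ) * Real.pi with hc
    have hcos : Real.cos c = 0 := cos_eq_zero_iff_int.2 ⟨k, hc⟩
    have hlev : ∀ t ∈ Set.Icc a b, t ≠ m → ψ t ≠ c := fun t ht htm h' ↦
      hne t ht htm (h' ▸ hcos)
    -- Under the last condition the level is not met on `[s, t]`, so `ψ` cannot change sides there.
    have hside : ∀ s t, a ≤ s → s ≤ t → t ≤ b → (t < m ∨ m < s ∨ ψ m ≠ c) →
        (ψ s < c ↔ ψ t < c) := by
      intro s t h1 h2 h3 h4
      have hcst : ContinuousOn ψ (Set.Icc s t) := hψ.mono (Set.Icc_subset_Icc h1 h3)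
      have hno : ∀ u ∈ Set.Icc s t, ψ u ≠ c := by
        intro u hu
        by_cases hum : u = m
        · subst hum
          rcases h4 with h4 | h4 | h4
          · exact absurd hu.2 (not_le.2 h4)
          · exact absurd hu.1 (not_le.2 h4)
          · exact h4
        · exact hlev u ⟨h1.trans hu.1, hu.2.trans h3⟩ hum
      constructor
      · intro hs
        by_contra! ht
        obtain ⟨u, hu, huc⟩ := intermediate_value_Icc h2 hcst ⟨hs.le, ht⟩
        exact hno u hu huc
      · intro ht
        by_contra! hs
        obtain ⟨u, hu, huc⟩ := intermediate_value_Icc' h2 hcst ⟨ht.le, hs⟩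
        exact hno u hu huc
    by_cases hm : ψ m = c
    · have hL : Tendsto ψ (𝓝[<] m) (𝓝 (ψ m)) := by
        rw [← nhdsWithin_Ioo_eq_nhdsLT ham]
        exact hmc.mono_left (nhdsWithin_mono _ fun v hv ↦ ⟨hv.1.le, (hv.2.trans hmb).le⟩)
      have hR : Tendsto ψ (𝓝[>] m) (𝓝 (ψ m)) := by
        rw [← nhdsWithin_Ioo_eq_nhdsGT hmb]
        exact hmc.mono_left (nhdsWithin_mono _ fun v hv ↦ ⟨(ham.trans hv.1).le, hv.2.le⟩)
      have hsin : Real.sin (ψ m) * Real.cos (ψ b) ≠ 0 := by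
        refine mul_ne_zero (fun h0 ↦ ?_) hb
        have := Real.sin_sq_add_cos_sq (ψ m)
        rw [h0, hm, hcos] at this
        norm_num at this
      have hb2 : 0 < Real.cos (ψ b) * Real.cos (ψ b) := mul_self_pos.2 hb
      have hmem : ∀ s ∈ Set.Ioo a m, s ∈ Set.Icc a b ∧ s ≠ m :=
        fun s hs ↦ ⟨⟨hs.1.le, (hs.2.trans hmb).le⟩, hs.2.ne⟩
      have hmem' : ∀ s ∈ Set.Ioo m b, s ∈ Set.Icc a b ∧ s ≠ m :=
        fun s hs ↦ ⟨⟨(ham.trans hs.1).le, hs.2.le⟩, hs.1.ne'⟩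
      -- The sign of `sin (ψ m) * cos (ψ t)` is the same before and after `m`, so `ψ` is on the same
      -- side of the level immediately before and after: it touches and returns.
      rcases lt_or_gt_of_ne hsin with hP | hP
      · have hsgn : ∀ t, t ∈ Set.Icc a b ∧ t ≠ m → Real.sin (ψ m) * Real.cos (ψ t) < 0 := by
          rintro t ⟨ht, htm⟩
          have := mul_neg_of_neg_of_pos hP (h t ht htm)
          by_contra! h'
          nlinarith [mul_nonneg h' hb2.le]
        obtain ⟨s, hs, hsm⟩ := ((eventually_lt_of_sin_mul_cos hL (hm ▸ hcos)
          (by filter_upwards [Ioo_mem_nhdsLT ham] with s hs using hsgn s (hmem s hs))).and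
          (Ioo_mem_nhdsLT ham)).exists
        obtain ⟨t, ht, htm⟩ := ((eventually_lt_of_sin_mul_cos hR (hm ▸ hcos)
          (by filter_upwards [Ioo_mem_nhdsGT hmb] with s hs using hsgn s (hmem' s hs))).and
          (Ioo_mem_nhdsGT hmb)).exists
        rw [hm] at hs ht
        rw [hside a s le_rfl hsm.1.le (hsm.2.trans hmb).le (Or.inl hsm.2),
          ← hside t b (ham.trans htm.1).le htm.2.le le_rfl (Or.inr (Or.inl htm.1))]
        exact ⟨fun h' ↦ absurd h' (not_lt.2 hs.le), fun h' ↦ absurd h' (not_lt.2 ht.le)⟩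
      · have hsgn : ∀ t, t ∈ Set.Icc a b ∧ t ≠ m → 0 < Real.sin (ψ m) * Real.cos (ψ t) := by
          rintro t ⟨ht, htm⟩
          have := mul_pos hP (h t ht htm)
          by_contra! h'
          nlinarith [mul_nonpos_of_nonpos_of_nonneg h' hb2.le]
        obtain ⟨s, hs, hsm⟩ := ((eventually_gt_of_sin_mul_cos hL (hm ▸ hcos)
          (by filter_upwards [Ioo_mem_nhdsLT ham] with s hs using hsgn s (hmem s hs))).and
          (Ioo_mem_nhdsLT ham)).exists
        obtain ⟨t, ht, htm⟩ := ((eventually_gt_of_sin_mul_cos hR (hm ▸ hcos)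
          (by filter_upwards [Ioo_mem_nhdsGT hmb] with s hs using hsgn s (hmem' s hs))).and
          (Ioo_mem_nhdsGT hmb)).exists
        rw [hm] at hs ht
        rw [hside a s le_rfl hsm.1.le (hsm.2.trans hmb).le (Or.inl hsm.2),
          ← hside t b (ham.trans htm.1).le htm.2.le le_rfl (Or.inr (Or.inl htm.1))]
        exact ⟨fun _ ↦ ht, fun _ ↦ hs⟩
    · exact hside a b le_rfl (ham.trans hmb).le le_rfl (Or.inr (Or.inr hm))
  refine le_antisymm ((le_cosCell_iff hb).2 ?_) ((le_cosCell_iff ha).2 ?_)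
  · refine lt_of_le_of_ne ?_ fun h' ↦ hb (cos_eq_zero_iff_int.2 ⟨_, h'.symm⟩)
    rw [← not_lt, ← key, not_lt]
    exact ((le_cosCell_iff ha).1 le_rfl).le
  · refine lt_of_le_of_ne ?_ fun h' ↦ ha (cos_eq_zero_iff_int.2 ⟨_, h'.symm⟩)
    rw [← not_lt, key, not_lt]
    exact ((le_cosCell_iff hb).1 le_rfl).le

/-- The number of zeros of `cos ∘ ψ` in terms of the number `w` of full turns that `ψ` makes
relative to a frame which turns by the angle `-D`. -/
theorem encard_cos_zeros_eq_two_mul_natAbs {m t₁ D : ℝ} {w : ℤ} (ha₁ : a < t₁) (h₁m : t₁ < m)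
    (hmb : m < b) (hψ : ContinuousOn ψ (Set.Icc a b)) (ha : Real.cos (ψ a) ≠ 0)
    (hcr : ∀ t ∈ Set.Ioo a t₁, Real.cos (ψ t) = 0 →
      (∀ᶠ s in 𝓝[>] t, ψ t < ψ s) ∧ ∀ᶠ s in 𝓝[<] t, ψ s < ψ t)
    (hsgn : ∀ t ∈ Set.Icc t₁ b, t ≠ m → 0 < Real.cos (ψ t) * Real.cos (ψ b))
    (hD : 0 < D) (hDπ : D < Real.pi) (hw : ψ b = ψ a + 2 * Real.pi * w + D) :
    {t | t ∈ Set.Ioo a t₁ ∧ Real.cos (ψ t) = 0}.encard =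
      ((2 * w.natAbs + if Real.cos (ψ a) * Real.cos (ψ b) < 0 then 1 else 0 : ℕ) : ℕ∞) := by
  have h₁b : t₁ < b := h₁m.trans hmb
  have h1 : 0 < Real.cos (ψ t₁) * Real.cos (ψ b) := hsgn t₁ ⟨le_rfl, h₁b.le⟩ h₁m.ne
  have hc1 : Real.cos (ψ t₁) ≠ 0 := fun h ↦ by simp [h] at h1
  have hcb : Real.cos (ψ b) ≠ 0 := fun h ↦ by simp [h] at h1
  obtain ⟨hle, hcard⟩ := encard_cos_zeros ha₁ (hψ.mono (Set.Icc_subset_Icc le_rfl h₁b.le)) ha hc1 hcr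
  have hcell := cosCell_eq_of_cos_pos h₁m hmb (hψ.mono (Set.Icc_subset_Icc ha₁.le le_rfl)) hsgn
  rw [hcell] at hle hcard
  have hodd := cos_mul_cos_neg_iff ha hcb
  -- A full turn crosses two cells, and the remaining `D < π` adds at most one more.
  have hb : cosCell (ψ b) = ⌊ψ a / Real.pi - 1 / 2 + D / Real.pi⌋ + 2 * w := by
    rw [cosCell, ← Int.floor_add_intCast, hw]
    congr 1
    push_cast
    field_simp
    ring
  have hδ0 : 0 < D / Real.pi := div_pos hD Real.pi_pos
  have hδ1 : D / Real.pi < 1 := (div_lt_one Real.pi_pos).2 hDπ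
  have hl : cosCell (ψ a) ≤ ⌊ψ a / Real.pi - 1 / 2 + D / Real.pi⌋ :=
    Int.floor_le_floor (by linarith)
  have hu : ⌊ψ a / Real.pi - 1 / 2 + D / Real.pi⌋ ≤ cosCell (ψ a) + 1 := by
    rw [cosCell, ← Int.floor_add_one]
    exact Int.floor_le_floor (by linarith)
  rw [hcard]
  congr 1
  -- The cell difference is `2 * w` plus `0` or `1`, and the parity decides which. Being
  -- nonnegative, it forces `w ≥ 0`, so that `natAbs` returns `w`.
  split_ifs with hneg
  · obtain ⟨j, hj⟩ := hodd.1 hneg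
    omega
  · obtain ⟨j, hj⟩ := Int.not_odd_iff_even.1 fun h ↦ hneg (hodd.2 h)
    omega

end Crossing

/-! ### Continuous angles and uniqueness of the winding number. -/

/-- A continuous path in the unit circle has a continuous angle. -/
theorem exists_continuousOn_angle {U : ℝ → Plane} {a b : ℝ} (hab : a < b)
    (hU : ContinuousOn U (Set.Icc a b)) (h1 : ∀ t ∈ Set.Icc a b, ‖U t‖ = 1) :
    ∃ θ : ℝ → ℝ, ContinuousOn θ (Set.Icc a b) ∧
      ∀ t ∈ Set.Icc a b, U t = !₂[Real.cos (θ t), Real.sin (θ t)] := by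
  have hba : 0 < b - a := sub_pos.2 hab
  have hmem : ∀ s : unitInterval, a + (b - a) * s ∈ Set.Icc a b := fun s ↦
    ⟨by nlinarith [s.2.1], by nlinarith [s.2.2]⟩
  have hcU : Continuous fun s : unitInterval ↦ U (a + (b - a) * s) :=
    hU.comp_continuous (by fun_prop) hmem
  have hnorm : ∀ s : unitInterval,
      (⟨U (a + (b - a) * s) 0, U (a + (b - a) * s) 1⟩ : ℂ) ∈ Submonoid.unitSphere ℂ := by
    intro s
    have := h1 _ (hmem s)
    rw [EuclideanSpace.norm_eq, Real.sqrt_eq_one, Fin.sum_univ_two, Real.norm_eq_abs,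
      Real.norm_eq_abs, sq_abs, sq_abs] at this
    change _ ∈ Metric.sphere (0 : ℂ) 1
    rw [mem_sphere_zero_iff_norm, Complex.norm_def, Real.sqrt_eq_one, Complex.normSq_mk]
    linarith
  have hcont : Continuous fun s : unitInterval ↦
      (⟨U (a + (b - a) * s) 0, U (a + (b - a) * s) 1⟩ : ℂ) := by
    have h0 : Continuous fun s : unitInterval ↦ U (a + (b - a) * s) 0 :=
      (EuclideanSpace.proj (𝕜 := ℝ) (0 : Fin 2)).continuous.comp hcU
    have h1 : Continuous fun s : unitInterval ↦ U (a + (b - a) * s) 1 :=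
      (EuclideanSpace.proj (𝕜 := ℝ) (1 : Fin 2)).continuous.comp hcU
    exact Complex.equivRealProdCLM.symm.continuous.comp (h0.prodMk h1)
  let γ : C(unitInterval, Circle) := ⟨fun s ↦ ⟨_, hnorm s⟩, hcont.subtype_mk hnorm⟩
  -- The angle is a lift through the covering of the circle by the real line; the argument of the
  -- starting point fixes the sheet.
  obtain ⟨Γ, hΓ, -⟩ := Circle.isCoveringMap_exp.exists_path_lifts γ (Complex.arg (γ 0))
    (Circle.exp_arg _).symm
  refine ⟨fun t ↦ Γ (Set.projIcc 0 1 zero_le_one ((t - a) / (b - a))), ?_, fun t ht ↦ ?_⟩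
  · exact (Γ.continuous.comp (continuous_projIcc.comp (by fun_prop))).continuousOn
  · have hs : (t - a) / (b - a) ∈ Set.Icc (0 : ℝ) 1 :=
      ⟨div_nonneg (by linarith [ht.1]) hba.le, (div_le_one hba).2 (by linarith [ht.2])⟩
    simp only [Set.projIcc_of_mem _ hs]
    have ht' : a + (b - a) * ((t - a) / (b - a)) = t := by field_simp; ring
    have hl : Complex.exp (Γ ⟨_, hs⟩ * Complex.I) = ⟨U t 0, U t 1⟩ := by
      rw [← Circle.coe_exp, ← Function.comp_apply (f := Circle.exp) (g := Γ), hΓ]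
      change (⟨U (a + (b - a) * ((t - a) / (b - a))) 0,
        U (a + (b - a) * ((t - a) / (b - a))) 1⟩ : ℂ) = _
      rw [ht']
    ext i
    fin_cases i
    · have := congrArg Complex.re hl
      simpa [Complex.exp_ofReal_mul_I_re] using this.symm
    · have := congrArg Complex.im hl
      simpa [Complex.exp_ofReal_mul_I_im] using this.symm

/-- The winding number is unique. -/
theorem HasWindingNumber.unique {γ : ℝ → Plane} {z : Plane} {w w' : ℤ}
    (h : HasWindingNumber γ z w) (h' : HasWindingNumber γ z w') : w' = w := by
  obtain ⟨θ, hθ, hγ, hw⟩ := h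
  obtain ⟨θ', hθ', hγ', hw'⟩ := h'
  have hcos : Set.EqOn (fun t ↦ Real.cos (θ' t - θ t)) (fun _ ↦ 1) (Set.Icc (-1) 2) := by
    -- The two angles are compared through `γ` only away from `0` and `1`; continuity and density
    -- supply the junctions.
    have hs : Set.EqOn (fun t ↦ Real.cos (θ' t - θ t)) (fun _ ↦ 1)
        (Set.Icc (-1) 2 \ {0, 1}) := by
      rintro t ⟨ht, htn⟩
      simp only [Set.mem_insert_iff, Set.mem_singleton_iff, not_or] at htn
      have h1 := (hγ t ht htn.1 htn.2).2.symm.trans (hγ' t ht htn.1 htn.2).2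
      have hc : Real.cos (θ t) = Real.cos (θ' t) := by simpa using congrArg (fun v : Plane ↦ v 0) h1
      have hsn : Real.sin (θ t) = Real.sin (θ' t) := by simpa using congrArg (fun v : Plane ↦ v 1) h1
      simp only [Real.cos_sub, hc, hsn]
      nlinarith [Real.sin_sq_add_cos_sq (θ' t)]
    refine hs.of_subset_closure (by fun_prop) (by fun_prop) Set.sdiff_subset ?_
    have hd : Dense ({0, 1}ᶜ : Set ℝ) := (Set.toFinite {0, 1}).countable.dense_compl ℝ
    have h2 := hd.open_subset_closure_inter (isOpen_Ioo (a := (-1 : ℝ)) (b := 2))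
    calc Set.Icc (-1 : ℝ) 2 = closure (Set.Ioo (-1) 2) := (closure_Ioo (by norm_num)).symm
      _ ⊆ closure (Set.Ioo (-1) 2 ∩ {0, 1}ᶜ) := closure_minimal h2 isClosed_closure
      _ ⊆ closure (Set.Icc (-1) 2 \ {0, 1}) := closure_mono fun t ht ↦ ⟨⟨ht.1.1.le, ht.1.2.le⟩, ht.2⟩
  have hint : ∀ t ∈ Set.Icc (-1 : ℝ) 2, ∃ n : ℤ, (n : ℝ) * (2 * Real.pi) = θ' t - θ t :=
    fun t ht ↦ (Real.cos_eq_one_iff _).1 (hcos ht)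
  have hdiff : ContinuousOn (fun t ↦ θ' t - θ t) (Set.Icc (-1) 2) := hθ'.sub hθ
  have hconst : θ' (-1) - θ (-1) = θ' 2 - θ 2 := by
    have hl : (-1 : ℝ) ∈ Set.Icc (-1 : ℝ) 2 := ⟨le_rfl, by norm_num⟩
    have hr : (2 : ℝ) ∈ Set.Icc (-1 : ℝ) 2 := ⟨by norm_num, le_rfl⟩
    -- The difference of the angles is continuous on an interval with values in the discrete group
    -- `2πℤ`.
    refine isPreconnected_Icc.constant_of_mapsTo
      (T := (AddSubgroup.zmultiples (2 * Real.pi) : Set ℝ)) ?_ hdiff (fun t ht ↦ ?_) hl hr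
    · rw [isDiscrete_iff_discreteTopology]
      exact inferInstanceAs (DiscreteTopology (AddSubgroup.zmultiples (2 * Real.pi)))
    · obtain ⟨n, hn⟩ := hint t ht
      exact ⟨n, by simpa using hn⟩
  have h3 : 2 * Real.pi * (w' : ℝ) = 2 * Real.pi * w := by linarith
  exact_mod_cast mul_left_cancel₀ (by positivity) h3

/-! ### Directions seen from `z`, in the frame of a line. -/

/-- The direction of a vector. -/
noncomputable def dir (y : Plane) : Plane := ‖y‖⁻¹ • y

theorem norm_dir {y : Plane} (hy : y ≠ 0) : ‖dir y‖ = 1 := by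
  rw [dir, norm_smul, norm_inv, norm_norm, inv_mul_cancel₀ (norm_ne_zero_iff.2 hy)]

theorem continuousAt_dir {y : Plane} (hy : y ≠ 0) : ContinuousAt dir y :=
  (continuousAt_id.norm.inv₀ (norm_ne_zero_iff.2 hy)).smul continuousAt_id

theorem dir_smul {r : ℝ} (hr : 0 < r) (y : Plane) : dir (r • y) = dir y := by
  rw [dir, dir, norm_smul, Real.norm_of_nonneg hr.le, smul_smul]
  congr 1
  field_simp

/-- If `f` escapes to infinity in the direction `v`, then so does `f - z`. -/
theorem tendsto_dir_sub {α : Type*} {l : Filter α} {f : α → Plane} {ρ : α → ℝ} {v : Plane}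
    (hv : ‖v‖ = 1) (hρ : Tendsto ρ l atTop) (hf : Tendsto (fun t ↦ (ρ t)⁻¹ • f t) l (𝓝 v))
    (z : Plane) : Tendsto (fun t ↦ dir (f t - z)) l (𝓝 v) := by
  have hv0 : v ≠ 0 := fun h ↦ by simp [h] at hv
  have h1 : Tendsto (fun t ↦ (ρ t)⁻¹ • f t - (ρ t)⁻¹ • z) l (𝓝 v) := by
    simpa using hf.sub ((tendsto_inv_atTop_zero.comp hρ).smul_const z)
  have h2 := (continuousAt_dir hv0).tendsto.comp h1
  have h3 : dir v = v := by rw [dir, hv, inv_one, one_smul]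
  rw [h3] at h2
  refine h2.congr' ?_
  filter_upwards [hρ.eventually_gt_atTop 0] with t ht
  rw [Function.comp_apply, ← smul_sub, dir_smul (inv_pos.2 ht)]

/-- In a frame adapted to the line `A + B y₀ + C y₁ = 0`, the sign of the cosine of the angle of
`y - z` tells on which side of the line the point `z` lies. -/
theorem exists_cos_sub_arctan {A B C θ : ℝ} {y z : Plane} (hB : B < 0) (hyz : y - z ≠ 0)
    (hy : A + B * y 0 + C * y 1 = 0)
    (hθ : dir (y - z) = !₂[Real.cos θ, Real.sin θ]) :
    ∃ r, 0 < r ∧ Real.cos (θ - Real.arctan (C / B)) = r * (A + B * z 0 + C * z 1) := by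
  have hn : 0 < ‖y - z‖ := norm_pos_iff.2 hyz
  have h0 : Real.cos θ = ‖y - z‖⁻¹ * (y 0 - z 0) := by
    simpa [dir] using (congrArg (fun v : Plane ↦ v 0) hθ).symm
  have h1 : Real.sin θ = ‖y - z‖⁻¹ * (y 1 - z 1) := by
    simpa [dir] using (congrArg (fun v : Plane ↦ v 1) hθ).symm
  have hs : 0 < √(1 + (C / B) ^ 2) := Real.sqrt_pos.2 (by positivity)
  -- The cosine is the scalar product of `dir (y - z)` with the unit normal proportional to `(1, C /
  -- B)`. The equation of the line at `y` turns it into the value at `z` divided by `-B > 0`.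
  refine ⟨‖y - z‖⁻¹ * (√(1 + (C / B) ^ 2))⁻¹ * (-B)⁻¹,
    mul_pos (by positivity) (inv_pos.2 (neg_pos.2 hB)), ?_⟩
  rw [Real.cos_sub, Real.cos_arctan, Real.sin_arctan, h0, h1]
  have hB' := hB.ne
  have : A = -(B * y 0 + C * y 1) := by linarith
  rw [this]
  field_simp
  ring

/-- The sign of the sine of the angle of `y - z`, when `y` is the contact point of a line that
passes through `z` and turns clockwise. -/
theorem sin_sub_arctan_mul_neg {A B C A' B' C' θ : ℝ} {y z : Plane} (hB : B < 0)
    (hW : B * C' - C * B' < 0) (hyz : y - z ≠ 0)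
    (hy : A + B * y 0 + C * y 1 = 0) (hy' : A' + B' * y 0 + C' * y 1 = 0)
    (hz : A + B * z 0 + C * z 1 = 0)
    (hθ : dir (y - z) = !₂[Real.cos θ, Real.sin θ]) :
    Real.sin (θ - Real.arctan (C / B)) * (A' + B' * z 0 + C' * z 1) < 0 := by
  have hn : 0 < ‖y - z‖ := norm_pos_iff.2 hyz
  have h0 : Real.cos θ = ‖y - z‖⁻¹ * (y 0 - z 0) := by
    simpa [dir] using (congrArg (fun v : Plane ↦ v 0) hθ).symm
  have h1 : Real.sin θ = ‖y - z‖⁻¹ * (y 1 - z 1) := by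
    simpa [dir] using (congrArg (fun v : Plane ↦ v 1) hθ).symm
  have hs : 0 < √(1 + (C / B) ^ 2) := Real.sqrt_pos.2 (by positivity)
  -- Both points lie on the line, so `y - z` is determined by `y 1 - z 1`. The sine is a positive
  -- multiple and the derivative at `z` a negative multiple of this number, the latter because the
  -- Wronskian is negative.
  have hd0 : y 0 - z 0 = -(C / B) * (y 1 - z 1) := by
    have hB' := hB.ne
    field_simp
    linarith
  have hd1 : y 1 - z 1 ≠ 0 := by
    intro h
    rw [h, mul_zero] at hd0
    refine hyz ?_
    ext i
    fin_cases i
    · simpa using hd0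
    · simpa using h
  have hd : A' + B' * z 0 + C' * z 1 = (B * C' - C * B') / (-B) * (y 1 - z 1) := by
    have h2 : A' + B' * z 0 + C' * z 1 = -(B' * (y 0 - z 0) + C' * (y 1 - z 1)) := by linarith
    have hB' := hB.ne
    rw [h2, hd0]
    field_simp
    ring
  have hsin : Real.sin (θ - Real.arctan (C / B)) =
      ‖y - z‖⁻¹ * (√(1 + (C / B) ^ 2))⁻¹ * (1 + (C / B) ^ 2) * (y 1 - z 1) := by
    rw [Real.sin_sub, Real.cos_arctan, Real.sin_arctan, h0, h1, hd0]
    field_simp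
    ring
  rw [hsin, hd]
  have h3 : (B * C' - C * B') / (-B) < 0 := div_neg_of_neg_of_pos hW (neg_pos.2 hB)
  have h4 : 0 < ‖y - z‖⁻¹ * (√(1 + (C / B) ^ 2))⁻¹ * (1 + (C / B) ^ 2) := by positivity
  have h5 : 0 < (y 1 - z 1) * (y 1 - z 1) := mul_self_pos.2 hd1
  nlinarith [mul_neg_of_pos_of_neg (mul_pos h4 h5) h3]

/-! ### Regular families of lines, their envelopes and the connecting pieces. -/

namespace LineFamily

variable {L : LineFamily}

/-- The scaled coefficients of the family converge to `A`, `B`, `C` with `B < 0`. -/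
structure LimitsAlong (L : LineFamily) (l : Filter ℝ) (A B C : ℝ) : Prop where
  tendsto_a : Tendsto (fun x ↦ L.scale x * L.a x) l (𝓝 A)
  tendsto_b : Tendsto (fun x ↦ L.scale x * L.b x) l (𝓝 B)
  tendsto_c : Tendsto (fun x ↦ L.scale x * L.c x) l (𝓝 C)
  neg : B < 0

theorem LimitsAlong.tendsto_F {l : Filter ℝ} {A B C : ℝ} (h : L.LimitsAlong l A B C)
    (z : Plane) :
    Tendsto (fun x ↦ L.scale x * L.F x z) l (𝓝 (A + B * z 0 + C * z 1)) := by
  refine ((h.tendsto_a.add (h.tendsto_b.mul_const (z 0))).add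
    (h.tendsto_c.mul_const (z 1))).congr fun x ↦ ?_
  rw [F]; ring

/-- The envelope escapes to infinity along `l`, in the direction `v` of the limiting line. -/
structure EscapesAlong (L : LineFamily) (l : Filter ℝ) (B C : ℝ) (v : Plane) : Prop where
  norm_eq : ‖v‖ = 1
  mem_line : B * v 0 + C * v 1 = 0
  tendsto_norm : Tendsto (fun x ↦ ‖L.eta x‖) l atTop
  tendsto_dir : Tendsto (fun x ↦ ‖L.eta x‖⁻¹ • L.eta x) l (𝓝 v)

/-- The standing assumptions on a family of lines: the lines turn clockwise, by less than a half
turn. -/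
structure IsRegular (L : LineFamily) : Prop where
  scale_pos : ∀ x, 0 < x → 0 < L.scale x
  contDiffOn_a : ContDiffOn ℝ 1 L.a (Set.Ioi 0)
  contDiffOn_b : ContDiffOn ℝ 1 L.b (Set.Ioi 0)
  contDiffOn_c : ContDiffOn ℝ 1 L.c (Set.Ioi 0)
  b_neg : ∀ x, 0 < x → L.b x < 0
  wronskian_neg : ∀ x, 0 < x → wronskian L.b L.c x < 0

theorem IsRegular.differentiableAt_a (hL : L.IsRegular) {x : ℝ} (hx : 0 < x) :
    DifferentiableAt ℝ L.a x :=
  (hL.contDiffOn_a.contDiffAt (Ioi_mem_nhds hx)).differentiableAt one_ne_zero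

theorem IsRegular.differentiableAt_b (hL : L.IsRegular) {x : ℝ} (hx : 0 < x) :
    DifferentiableAt ℝ L.b x :=
  (hL.contDiffOn_b.contDiffAt (Ioi_mem_nhds hx)).differentiableAt one_ne_zero

theorem IsRegular.differentiableAt_c (hL : L.IsRegular) {x : ℝ} (hx : 0 < x) :
    DifferentiableAt ℝ L.c x :=
  (hL.contDiffOn_c.contDiffAt (Ioi_mem_nhds hx)).differentiableAt one_ne_zero

theorem IsRegular.hasDerivAt_F (hL : L.IsRegular) {x : ℝ} (hx : 0 < x) (z : Plane) :
    HasDerivAt (fun y ↦ L.F y z) (deriv L.a x + deriv L.b x * z 0 + deriv L.c x * z 1) x :=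
  ((hL.differentiableAt_a hx).hasDerivAt.add
    ((hL.differentiableAt_b hx).hasDerivAt.mul_const (z 0))).add
    ((hL.differentiableAt_c hx).hasDerivAt.mul_const (z 1))

theorem IsRegular.eta_spec (hL : L.IsRegular) {x : ℝ} (hx : 0 < x) :
    L.F x (L.eta x) = 0 ∧
      deriv L.a x + deriv L.b x * L.eta x 0 + deriv L.c x * L.eta x 1 = 0 := by
  rw [← (hL.hasDerivAt_F hx _).deriv]
  exact (L.eq_eta_iff x _ (hL.differentiableAt_a hx) (hL.differentiableAt_b hx)
    (hL.differentiableAt_c hx) (hL.wronskian_neg x hx).ne).1 rfl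

theorem IsRegular.eta_mem_envelope (hL : L.IsRegular) {x : ℝ} (hx : 0 < x) :
    L.eta x ∈ L.envelope :=
  ⟨x, hx, (hL.eta_spec hx).1, (hL.hasDerivAt_F hx _).deriv.trans (hL.eta_spec hx).2⟩

theorem continuousOn_wronskian {f g : ℝ → ℝ} (hf : ContDiffOn ℝ 1 f (Set.Ioi 0))
    (hg : ContDiffOn ℝ 1 g (Set.Ioi 0)) : ContinuousOn (wronskian f g) (Set.Ioi 0) :=
  (hf.continuousOn.mul (hg.continuousOn_deriv_of_isOpen isOpen_Ioi le_rfl)).sub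
    (hg.continuousOn.mul (hf.continuousOn_deriv_of_isOpen isOpen_Ioi le_rfl))

theorem continuousAt_plane {f g : ℝ → ℝ} {x : ℝ} (hf : ContinuousAt f x)
    (hg : ContinuousAt g x) : ContinuousAt (fun y ↦ (!₂[f y, g y] : Plane)) x := by
  refine (PiLp.continuous_toLp 2 _).continuousAt.comp (continuousAt_pi.2 fun i ↦ ?_)
  fin_cases i
  · exact hf
  · exact hg

theorem IsRegular.continuousAt_eta (hL : L.IsRegular) {x : ℝ} (hx : 0 < x) :
    ContinuousAt L.eta x := by
  have hmem : Set.Ioi (0 : ℝ) ∈ 𝓝 x := Ioi_mem_nhds hx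
  have hW := (hL.wronskian_neg x hx).ne
  have hbc := (continuousOn_wronskian hL.contDiffOn_b hL.contDiffOn_c).continuousAt hmem
  exact continuousAt_plane
    (((continuousOn_wronskian hL.contDiffOn_c hL.contDiffOn_a).continuousAt hmem).div hbc hW)
    (((continuousOn_wronskian hL.contDiffOn_a hL.contDiffOn_b).continuousAt hmem).div hbc hW)

/-- If `η` converges, then the limit lies on the limiting line. -/
theorem LimitsAlong.mem_line {l : Filter ℝ} [l.NeBot] {A B C : ℝ} (h : L.LimitsAlong l A B C)
    (hl : ∀ᶠ x in l, L.F x (L.eta x) = 0) {e : Plane} (he : Tendsto L.eta l (𝓝 e)) :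
    A + B * e 0 + C * e 1 = 0 := by
  have h0 := ((EuclideanSpace.proj (𝕜 := ℝ) (0 : Fin 2)).continuous.tendsto e).comp he
  have h1 := ((EuclideanSpace.proj (𝕜 := ℝ) (1 : Fin 2)).continuous.tendsto e).comp he
  have h2 := (h.tendsto_a.add (h.tendsto_b.mul h0)).add (h.tendsto_c.mul h1)
  refine tendsto_nhds_unique h2 (tendsto_const_nhds.congr' ?_)
  filter_upwards [hl] with x hx
  rw [F] at hx
  change 0 = L.scale x * L.a x + L.scale x * L.b x * L.eta x 0 + L.scale x * L.c x * L.eta x 1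
  linear_combination (-L.scale x) * hx

/-- The same map `s / (1 - s)` parametrizes the envelope and the connecting ray, so both ends at
infinity are handled by this limit. -/
theorem tendsto_div_one_sub : Tendsto (fun s : ℝ ↦ s / (1 - s)) (𝓝[<] 1) atTop := by
  have h1 : Tendsto (fun s : ℝ ↦ 1 - s) (𝓝[<] 1) (𝓝[>] 0) := by
    refine tendsto_nhdsWithin_iff.2 ⟨?_, ?_⟩
    · have : Tendsto (fun s : ℝ ↦ 1 - s) (𝓝 1) (𝓝 (1 - 1)) := by
        exact (continuous_const.sub continuous_id).tendsto 1
      rw [sub_self] at this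
      exact this.mono_left nhdsWithin_le_nhds
    · filter_upwards [self_mem_nhdsWithin] with s hs
      exact sub_pos.2 (Set.mem_Iio.1 hs)
  have h2 : Tendsto (fun s : ℝ ↦ s) (𝓝[<] 1) (𝓝 1) := nhdsWithin_le_nhds
  exact h2.pos_mul_atTop one_pos (tendsto_inv_nhdsGT_zero.comp h1)

/-- The connecting piece of the augmented envelope lies on the limiting line, and at its end it has
the same direction, seen from a point `z` off the limiting line, as the end of the envelope. -/
theorem LimitsAlong.connect_spec {l : Filter ℝ} [l.NeBot] {A B C : ℝ}
    (h : L.LimitsAlong l A B C) (hl : ∀ᶠ x in l, L.F x (L.eta x) = 0)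
    (hc : (∃ e, Tendsto L.eta l (𝓝 e)) ∨ ∃ v, L.EscapesAlong l B C v)
    {M z : Plane} (hM : A + B * M 0 + C * M 1 = 0) (hz : A + B * z 0 + C * z 1 ≠ 0) :
    L.connect M l 0 = M ∧ ContinuousOn (L.connect M l) (Set.Iio 1) ∧
      (∀ s, A + B * L.connect M l s 0 + C * L.connect M l s 1 = 0) ∧
      ∃ v, ‖v‖ = 1 ∧ Tendsto (fun x ↦ dir (L.eta x - z)) l (𝓝 v) ∧
        Tendsto (fun s ↦ dir (L.connect M l s - z)) (𝓝[<] 1) (𝓝 v) ∧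
        ((∃ e, Tendsto L.eta l (𝓝 e)) →
          ∃ e, A + B * e 0 + C * e 1 = 0 ∧ e - z ≠ 0 ∧ v = dir (e - z)) := by
  by_cases hconv : ∃ e, Tendsto L.eta l (𝓝 e)
  · obtain ⟨e, he⟩ := hconv
    have hfun : L.connect M l = fun s ↦ AffineMap.lineMap M e s := by
      ext1 s
      rw [connect, if_pos ⟨e, he⟩, he.limUnder_eq]
    have heline := h.mem_line hl he
    have hez : e - z ≠ 0 := fun h0 ↦ hz (by rw [← sub_eq_zero.1 h0]; exact heline)
    have hcont : Continuous fun s : ℝ ↦ (AffineMap.lineMap M e s : Plane) :=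
      AffineMap.lineMap_continuous
    rw [hfun]
    refine ⟨by simp, hcont.continuousOn, fun s ↦ ?_, dir (e - z), norm_dir hez,
      (continuousAt_dir hez).tendsto.comp (he.sub_const z), ?_,
      fun _ ↦ ⟨e, heline, hez, rfl⟩⟩
    · simp only [AffineMap.lineMap_apply_module, PiLp.add_apply, PiLp.smul_apply, smul_eq_mul]
      linear_combination (1 - s) * hM + s * heline
    · have h1 : Tendsto (fun s : ℝ ↦ (AffineMap.lineMap M e s : Plane)) (𝓝[<] 1) (𝓝 e) := by
        have := hcont.tendsto 1
        rw [AffineMap.lineMap_apply_one] at this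
        exact this.mono_left nhdsWithin_le_nhds
      exact (continuousAt_dir hez).tendsto.comp (h1.sub_const z)
  · obtain ⟨v, hv⟩ := hc.resolve_left hconv
    have hfun : L.connect M l = fun s ↦ M + (s / (1 - s)) • v := by
      ext1 s
      rw [connect, if_neg hconv, hv.tendsto_dir.limUnder_eq]
    rw [hfun]
    refine ⟨by simp, ?_, fun s ↦ ?_, v, hv.norm_eq,
      tendsto_dir_sub hv.norm_eq hv.tendsto_norm hv.tendsto_dir z, ?_, fun h' ↦ absurd h' hconv⟩
    · have h1 : ContinuousOn (fun s : ℝ ↦ s / (1 - s)) (Set.Iio 1) :=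
        continuousOn_id.div (continuousOn_const.sub continuousOn_id)
          fun s hs ↦ (sub_pos.2 (Set.mem_Iio.1 hs)).ne'
      exact continuousOn_const.add (h1.smul continuousOn_const)
    · simp only [PiLp.add_apply, PiLp.smul_apply, smul_eq_mul]
      linear_combination hM + (s / (1 - s)) * hv.mem_line
    · refine tendsto_dir_sub hv.norm_eq tendsto_div_one_sub ?_ z
      have h1 := ((tendsto_inv_atTop_zero.comp tendsto_div_one_sub).smul_const M).add_const v
      rw [zero_smul, zero_add] at h1
      refine h1.congr' ?_
      filter_upwards [tendsto_div_one_sub.eventually_gt_atTop 0] with s hs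
      rw [smul_add, smul_smul, inv_mul_cancel₀ hs.ne', one_smul, Function.comp_apply]

end LineFamily

/-! ### Gluing the three pieces of a path at the two junctions. -/

section Glue

variable {X : Type*} {f g h : ℝ → X} {p q : X}

/-- Three functions on `[-1, 0)`, `(0, 1)`, `(1, 2]`, glued at `0` and `1`. -/
noncomputable def glue (f : ℝ → X) (p : X) (g : ℝ → X) (q : X) (h : ℝ → X) (t : ℝ) : X :=
  if t < 0 then f t else if t = 0 then p else if t < 1 then g t else if t = 1 then q else h t

theorem glue_of_neg {t : ℝ} (ht : t < 0) : glue f p g q h t = f t := if_pos ht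

theorem glue_zero : glue f p g q h 0 = p := by simp [glue]

theorem glue_of_mem {t : ℝ} (ht : t ∈ Set.Ioo (0 : ℝ) 1) : glue f p g q h t = g t := by
  rw [glue, if_neg (not_lt.2 ht.1.le), if_neg ht.1.ne', if_pos ht.2]

theorem glue_one : glue f p g q h 1 = q := by simp [glue]

theorem glue_of_one_lt {t : ℝ} (ht : 1 < t) : glue f p g q h t = h t := by
  rw [glue, if_neg (by linarith), if_neg (by linarith), if_neg (by linarith), if_neg ht.ne']

theorem continuousOn_glue [TopologicalSpace X] (hf : ∀ t ∈ Set.Ico (-1 : ℝ) 0, ContinuousAt f t)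
    (hg : ∀ t ∈ Set.Ioo (0 : ℝ) 1, ContinuousAt g t)
    (hh : ∀ t ∈ Set.Ioc (1 : ℝ) 2, ContinuousAt h t)
    (hfp : Tendsto f (𝓝[<] 0) (𝓝 p)) (hgp : Tendsto g (𝓝[>] 0) (𝓝 p))
    (hgq : Tendsto g (𝓝[<] 1) (𝓝 q)) (hhq : Tendsto h (𝓝[>] 1) (𝓝 q)) :
    ContinuousOn (glue f p g q h) (Set.Icc (-1) 2) := by
  intro t ht
  refine ContinuousAt.continuousWithinAt ?_
  rcases lt_trichotomy t 0 with h0 | rfl | h0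
  · refine (hf t ⟨ht.1, h0⟩).congr ?_
    filter_upwards [Iio_mem_nhds h0] with s hs using (glue_of_neg hs).symm
  · rw [continuousAt_iff_continuous_left'_right', ContinuousWithinAt, ContinuousWithinAt, glue_zero]
    refine ⟨hfp.congr' ?_, hgp.congr' ?_⟩
    · filter_upwards [self_mem_nhdsWithin] with s hs using (glue_of_neg hs).symm
    · filter_upwards [Ioo_mem_nhdsGT one_pos] with s hs using (glue_of_mem hs).symm
  rcases lt_trichotomy t 1 with h1 | rfl | h1
  · refine (hg t ⟨h0, h1⟩).congr ?_
    filter_upwards [Ioo_mem_nhds h0 h1] with s hs using (glue_of_mem hs).symm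
  · rw [continuousAt_iff_continuous_left'_right', ContinuousWithinAt, ContinuousWithinAt, glue_one]
    refine ⟨hgq.congr' ?_, hhq.congr' ?_⟩
    · filter_upwards [Ioo_mem_nhdsLT one_pos] with s hs using (glue_of_mem hs).symm
    · filter_upwards [self_mem_nhdsWithin] with s hs using (glue_of_one_lt hs).symm
  · refine (hh t ⟨h1, ht.2⟩).congr ?_
    filter_upwards [Ioi_mem_nhds h1] with s hs using (glue_of_one_lt hs).symm

end Glue

/-- A function is negative to the right and positive to the left of a zero with negative
derivative. -/
theorem eventually_neg_pos_of_deriv_neg {H : ℝ → ℝ} {t d : ℝ} (hH : HasDerivAt H d t)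
    (hd : d < 0) (h0 : H t = 0) : (∀ᶠ s in 𝓝[>] t, H s < 0) ∧ ∀ᶠ s in 𝓝[<] t, 0 < H s := by
  have h := eventually_nhdsWithin_sign_eq_of_deriv_neg (hH.deriv.symm ▸ hd) h0
  constructor
  · filter_upwards [nhdsWithin_le_nhds h, self_mem_nhdsWithin] with s hs hts
    rw [sign_neg (sub_neg.2 hts)] at hs
    exact sign_eq_neg_one_iff.1 hs
  · filter_upwards [nhdsWithin_le_nhds h, self_mem_nhdsWithin] with s hs hts
    rw [sign_pos (sub_pos.2 hts)] at hs
    exact sign_eq_one_iff.1 hs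

theorem tendsto_div_one_sub_zero : Tendsto (fun s : ℝ ↦ s / (1 - s)) (𝓝[>] 0) (𝓝[>] 0) := by
  refine tendsto_nhdsWithin_iff.2 ⟨?_, ?_⟩
  · have h1 : ContinuousAt (fun s : ℝ ↦ s / (1 - s)) 0 :=
      continuousAt_id.div (continuousAt_const.sub continuousAt_id) (by norm_num)
    have h2 := h1.tendsto
    rw [zero_div] at h2
    exact h2.mono_left nhdsWithin_le_nhds
  · filter_upwards [Ioo_mem_nhdsGT one_pos] with s hs
    exact div_pos hs.1 (sub_pos.2 hs.2)

theorem hasDerivAt_div_one_sub {t : ℝ} (ht : t < 1) :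
    HasDerivAt (fun s : ℝ ↦ s / (1 - s)) (1 / (1 - t) ^ 2) t := by
  have h0 : (1 - t) ≠ 0 := (sub_pos.2 ht).ne'
  refine ((hasDerivAt_id t).div ((hasDerivAt_id t).const_sub 1) h0).congr_deriv ?_
  simp only [id]
  ring

/-! ### The angle of the augmented envelope relative to the normals of the lines. -/

namespace LineFamily

variable {L : LineFamily}

/-- The angle of the normal of the line `ℓ_x`, in terms of the parameter `t` of the augmented
envelope. -/
noncomputable def frameAngle (L : LineFamily) (B₀ C₀ B₁ C₁ : ℝ) : ℝ → ℝ :=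
  glue (fun _ ↦ Real.arctan (C₀ / B₀)) (Real.arctan (C₀ / B₀))
    (fun t ↦ Real.arctan (L.c (t / (1 - t)) / L.b (t / (1 - t))))
    (Real.arctan (C₁ / B₁)) (fun _ ↦ Real.arctan (C₁ / B₁))

theorem LimitsAlong.tendsto_arctan (hL : L.IsRegular) {l : Filter ℝ} {A B C : ℝ}
    (h : L.LimitsAlong l A B C) (hl : ∀ᶠ x in l, 0 < x) :
    Tendsto (fun x ↦ Real.arctan (L.c x / L.b x)) l (𝓝 (Real.arctan (C / B))) := by
  refine (Real.continuous_arctan.tendsto _).comp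
    ((h.tendsto_c.div h.tendsto_b h.neg.ne).congr' ?_)
  filter_upwards [hl] with x hx
  exact mul_div_mul_left _ _ (hL.scale_pos x hx).ne'

theorem continuousOn_frameAngle (hL : L.IsRegular) {A₀ B₀ C₀ A₁ B₁ C₁ : ℝ}
    (h₀ : L.LimitsAlong (𝓝[>] 0) A₀ B₀ C₀) (h₁ : L.LimitsAlong atTop A₁ B₁ C₁) :
    ContinuousOn (L.frameAngle B₀ C₀ B₁ C₁) (Set.Icc (-1) 2) := by
  refine continuousOn_glue (fun _ _ ↦ continuousAt_const) (fun t ht ↦ ?_)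
    (fun _ _ ↦ continuousAt_const) tendsto_const_nhds
    ((h₀.tendsto_arctan hL self_mem_nhdsWithin).comp tendsto_div_one_sub_zero)
    ((h₁.tendsto_arctan hL (eventually_gt_atTop 0)).comp tendsto_div_one_sub) tendsto_const_nhds
  have hx : 0 < t / (1 - t) := div_pos ht.1 (sub_pos.2 ht.2)
  have h1 : ContinuousAt (fun x ↦ Real.arctan (L.c x / L.b x)) (t / (1 - t)) :=
    Real.continuous_arctan.continuousAt.comp
      ((hL.differentiableAt_c hx).continuousAt.div (hL.differentiableAt_b hx).continuousAt
        (hL.b_neg _ hx).ne)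
  exact h1.comp (f := fun s ↦ s / (1 - s)) (hasDerivAt_div_one_sub ht.2).continuousAt

/-- The value `F(x, z)` in terms of the parameter `t` of the augmented envelope. -/
noncomputable def side (L : LineFamily) (A₀ B₀ C₀ A₁ B₁ C₁ : ℝ) (z : Plane) : ℝ → ℝ :=
  glue (fun _ ↦ A₀ + B₀ * z 0 + C₀ * z 1) (A₀ + B₀ * z 0 + C₀ * z 1)
    (fun t ↦ L.F (t / (1 - t)) z)
    (A₁ + B₁ * z 0 + C₁ * z 1) (fun _ ↦ A₁ + B₁ * z 0 + C₁ * z 1)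

theorem augmentedEnvelope_of_neg {M : Plane} {t : ℝ} (ht : t < 0) :
    L.augmentedEnvelope M t = L.connect M (𝓝[>] 0) (t + 1) := if_pos ht

theorem augmentedEnvelope_of_mem {M : Plane} {t : ℝ} (ht : t ∈ Set.Ioo (0 : ℝ) 1) :
    L.augmentedEnvelope M t = L.eta (t / (1 - t)) := by
  rw [augmentedEnvelope, if_neg (not_lt.2 ht.1.le), if_pos ht.2]

theorem augmentedEnvelope_of_one_lt {M : Plane} {t : ℝ} (ht : 1 < t) :
    L.augmentedEnvelope M t = L.connect M atTop (2 - t) := by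
  rw [augmentedEnvelope, if_neg (by linarith), if_neg (by linarith)]

theorem ne_of_line {A B C : ℝ} {y z : Plane} (hy : A + B * y 0 + C * y 1 = 0)
    (hz : A + B * z 0 + C * z 1 ≠ 0) : y - z ≠ 0 := fun h ↦ by
  rw [sub_eq_zero.1 h] at hy
  exact hz hy

/-- The angle of the augmented envelope around `z`, relative to the frame. -/
theorem exists_angle (hL : L.IsRegular) {A₀ B₀ C₀ A₁ B₁ C₁ : ℝ}
    (h₀ : L.LimitsAlong (𝓝[>] 0) A₀ B₀ C₀) (h₁ : L.LimitsAlong atTop A₁ B₁ C₁)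
    (hc₀ : ∃ e, Tendsto L.eta (𝓝[>] 0) (𝓝 e))
    (hc₁ : (∃ e, Tendsto L.eta atTop (𝓝 e)) ∨ ∃ v, L.EscapesAlong atTop B₁ C₁ v)
    {M z : Plane} (hM₀ : A₀ + B₀ * M 0 + C₀ * M 1 = 0) (hM₁ : A₁ + B₁ * M 0 + C₁ * M 1 = 0)
    (hz₀ : A₀ + B₀ * z 0 + C₀ * z 1 ≠ 0) (hz₁ : A₁ + B₁ * z 0 + C₁ * z 1 ≠ 0)
    (hz : z ∉ L.envelope) :
    ∃ (θ : ℝ → ℝ) (w : ℤ), ContinuousOn θ (Set.Icc (-1) 2) ∧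
      (∀ t ∈ Set.Icc (-1 : ℝ) 2, t ≠ 0 → t ≠ 1 →
        L.augmentedEnvelope M t ≠ z ∧ ‖L.augmentedEnvelope M t - z‖⁻¹ •
          (L.augmentedEnvelope M t - z) = !₂[Real.cos (θ t), Real.sin (θ t)]) ∧
      θ 2 - θ (-1) = 2 * Real.pi * w ∧
      ∀ t ∈ Set.Icc (-1 : ℝ) 2, t ≠ 1 → ∃ r, 0 < r ∧
        Real.cos (θ t - L.frameAngle B₀ C₀ B₁ C₁ t) = r * L.side A₀ B₀ C₀ A₁ B₁ C₁ z t := by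
  have hpos₀ : ∀ᶠ x in 𝓝[>] (0 : ℝ), L.F x (L.eta x) = 0 := by
    filter_upwards [self_mem_nhdsWithin] with x hx using (hL.eta_spec hx).1
  have hpos₁ : ∀ᶠ x in atTop, L.F x (L.eta x) = 0 := by
    filter_upwards [eventually_gt_atTop 0] with x hx using (hL.eta_spec hx).1
  obtain ⟨hs₀, hcn₀, hl₀, v₀, hv₀, ht₀, hd₀, he₀⟩ :=
    h₀.connect_spec hpos₀ (Or.inl hc₀) hM₀ hz₀
  -- Since `η` converges at `0`, the direction at `t = 0` points to a point of the limiting line,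
  -- and the cosine formula holds there as well. At `t = 1` the direction may be parallel to the
  -- limiting line, which is why that point is excluded.
  obtain ⟨e, hel, hez, hve⟩ := he₀ hc₀
  obtain ⟨hs₁, hcn₁, hl₁, v₁, hv₁, ht₁, hd₁, -⟩ := h₁.connect_spec hpos₁ hc₁ hM₁ hz₁
  have hx : ∀ {t : ℝ}, t ∈ Set.Ioo (0 : ℝ) 1 → 0 < t / (1 - t) :=
    fun ht ↦ div_pos ht.1 (sub_pos.2 ht.2)
  have hne₀ : ∀ s, L.connect M (𝓝[>] 0) s - z ≠ 0 := fun s ↦ ne_of_line (hl₀ s) hz₀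
  have hne₁ : ∀ s, L.connect M atTop s - z ≠ 0 := fun s ↦ ne_of_line (hl₁ s) hz₁
  have hneη : ∀ {x : ℝ}, 0 < x → L.eta x - z ≠ 0 := fun hx h ↦
    hz (sub_eq_zero.1 h ▸ hL.eta_mem_envelope hx)
  -- The direction extends continuously over both junctions, even if the augmented envelope itself
  -- does not.
  set U : ℝ → Plane := glue (fun t ↦ dir (L.connect M (𝓝[>] 0) (t + 1) - z)) v₀
    (fun t ↦ dir (L.eta (t / (1 - t)) - z)) v₁ (fun t ↦ dir (L.connect M atTop (2 - t) - z)) with hU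
  have hUc : ContinuousOn U (Set.Icc (-1) 2) := by
    refine continuousOn_glue (fun t ht ↦ ?_) (fun t ht ↦ ?_) (fun t ht ↦ ?_) ?_
      (ht₀.comp tendsto_div_one_sub_zero) (ht₁.comp tendsto_div_one_sub) ?_
    · have h1 : ContinuousAt (L.connect M (𝓝[>] 0)) (t + 1) :=
        hcn₀.continuousAt (Iio_mem_nhds (by linarith [ht.2]))
      have h2 : ContinuousAt (fun s ↦ L.connect M (𝓝[>] 0) (s + 1)) t :=
        h1.comp (f := fun s ↦ s + 1) (by fun_prop)
      exact (continuousAt_dir (hne₀ _)).comp (f := fun s ↦ L.connect M (𝓝[>] 0) (s + 1) - z)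
        (h2.sub continuousAt_const)
    · have h2 : ContinuousAt (fun s ↦ L.eta (s / (1 - s))) t :=
        (hL.continuousAt_eta (hx ht)).comp (f := fun s ↦ s / (1 - s))
          (hasDerivAt_div_one_sub ht.2).continuousAt
      exact (continuousAt_dir (hneη (hx ht))).comp (f := fun s ↦ L.eta (s / (1 - s)) - z)
        (h2.sub continuousAt_const)
    · have h1 : ContinuousAt (L.connect M atTop) (2 - t) :=
        hcn₁.continuousAt (Iio_mem_nhds (by linarith [ht.1]))
      have h2 : ContinuousAt (fun s ↦ L.connect M atTop (2 - s)) t :=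
        h1.comp (f := fun s ↦ 2 - s) (by fun_prop)
      exact (continuousAt_dir (hne₁ _)).comp (f := fun s ↦ L.connect M atTop (2 - s) - z)
        (h2.sub continuousAt_const)
    · refine hd₀.comp (tendsto_nhdsWithin_iff.2 ⟨?_, ?_⟩)
      · have : Tendsto (fun t : ℝ ↦ t + 1) (𝓝 0) (𝓝 (0 + 1)) :=
          (continuous_id.add continuous_const).tendsto 0
        rw [zero_add] at this
        exact this.mono_left nhdsWithin_le_nhds
      · filter_upwards [self_mem_nhdsWithin] with t ht
        simpa using ht
    · refine hd₁.comp (tendsto_nhdsWithin_iff.2 ⟨?_, ?_⟩)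
      · have : Tendsto (fun t : ℝ ↦ 2 - t) (𝓝 1) (𝓝 (2 - 1)) :=
          (continuous_const.sub continuous_id).tendsto 1
        rw [show (2 : ℝ) - 1 = 1 by norm_num] at this
        exact this.mono_left nhdsWithin_le_nhds
      · filter_upwards [self_mem_nhdsWithin] with t ht
        have : 1 < t := ht
        exact Set.mem_Iio.2 (by linarith)
  have hU1 : ∀ t ∈ Set.Icc (-1 : ℝ) 2, ‖U t‖ = 1 := by
    intro t ht
    rcases lt_trichotomy t 0 with h0 | rfl | h0
    · rw [hU, glue_of_neg h0]; exact norm_dir (hne₀ _)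
    · rw [hU, glue_zero]; exact hv₀
    rcases lt_trichotomy t 1 with h1 | rfl | h1
    · rw [hU, glue_of_mem ⟨h0, h1⟩]; exact norm_dir (hneη (hx ⟨h0, h1⟩))
    · rw [hU, glue_one]; exact hv₁
    · rw [hU, glue_of_one_lt h1]; exact norm_dir (hne₁ _)
  obtain ⟨θ, hθ, hθU⟩ := exists_continuousOn_angle (by norm_num) hUc hU1
  have hl : (-1 : ℝ) ∈ Set.Icc (-1 : ℝ) 2 := ⟨le_rfl, by norm_num⟩
  have hr : (2 : ℝ) ∈ Set.Icc (-1 : ℝ) 2 := ⟨by norm_num, le_rfl⟩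
  have hclosed : U 2 = U (-1) := by
    rw [hU, glue_of_one_lt (by norm_num), glue_of_neg (by norm_num)]
    norm_num [hs₀, hs₁]
  obtain ⟨w, hw⟩ : ∃ w : ℤ, (w : ℝ) * (2 * Real.pi) = θ 2 - θ (-1) := by
    rw [← Real.cos_eq_one_iff, Real.cos_sub]
    rw [hθU _ hl, hθU _ hr] at hclosed
    have h0 : Real.cos (θ 2) = Real.cos (θ (-1)) := by
      simpa using congrArg (fun v : Plane ↦ v 0) hclosed
    have h1 : Real.sin (θ 2) = Real.sin (θ (-1)) := by
      simpa using congrArg (fun v : Plane ↦ v 1) hclosed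
    rw [h0, h1]
    nlinarith [Real.sin_sq_add_cos_sq (θ (-1))]
  refine ⟨θ, w, hθ, fun t ht h0 h1 ↦ ?_, by rw [← hw]; ring, fun t ht h1 ↦ ?_⟩
  · have hθt := hθU t ht
    rcases lt_or_gt_of_ne h0 with h0 | h0
    · rw [augmentedEnvelope_of_neg h0]
      rw [hU, glue_of_neg h0] at hθt
      exact ⟨sub_ne_zero.1 (hne₀ _), hθt⟩
    rcases lt_or_gt_of_ne h1 with h1 | h1
    · rw [augmentedEnvelope_of_mem ⟨h0, h1⟩]
      rw [hU, glue_of_mem ⟨h0, h1⟩] at hθt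
      exact ⟨sub_ne_zero.1 (hneη (hx ⟨h0, h1⟩)), hθt⟩
    · rw [augmentedEnvelope_of_one_lt h1]
      rw [hU, glue_of_one_lt h1] at hθt
      exact ⟨sub_ne_zero.1 (hne₁ _), hθt⟩
  · have hθt := hθU t ht
    rw [frameAngle, side]
    rcases lt_trichotomy t 0 with h0 | rfl | h0
    · rw [hU, glue_of_neg h0] at hθt
      rw [glue_of_neg h0, glue_of_neg h0]
      exact exists_cos_sub_arctan h₀.neg (hne₀ _) (hl₀ _) hθt
    · rw [hU, glue_zero, hve] at hθt
      rw [glue_zero, glue_zero]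
      exact exists_cos_sub_arctan h₀.neg hez hel hθt
    rcases lt_or_gt_of_ne h1 with h1 | h1
    · rw [hU, glue_of_mem ⟨h0, h1⟩] at hθt
      rw [glue_of_mem ⟨h0, h1⟩, glue_of_mem ⟨h0, h1⟩]
      have hx' := hx ⟨h0, h1⟩
      exact exists_cos_sub_arctan (hL.b_neg _ hx') (hneη hx') (hL.eta_spec hx').1 hθt
    · rw [hU, glue_of_one_lt h1] at hθt
      rw [glue_of_one_lt h1, glue_of_one_lt h1]
      exact exists_cos_sub_arctan h₁.neg (hne₁ _) (hl₁ _) hθt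

end LineFamily

/-! ### The winding number counts the zeros of `F(·, z)`. -/

namespace LineFamily

variable {L : LineFamily}

theorem LimitsAlong.F₀_eq {A B C : ℝ} (h : L.LimitsAlong (𝓝[>] 0) A B C) (z : Plane) :
    L.F₀ z = A + B * z 0 + C * z 1 := (h.tendsto_F z).limUnder_eq

theorem LimitsAlong.Finf_eq {A B C : ℝ} (h : L.LimitsAlong atTop A B C) (z : Plane) :
    L.Finf z = A + B * z 0 + C * z 1 := (h.tendsto_F z).limUnder_eq

/-- The limiting lines intersect in exactly one point. -/
theorem exists_line₀_inter_lineInf {A₀ B₀ C₀ A₁ B₁ C₁ : ℝ}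
    (h₀ : L.LimitsAlong (𝓝[>] 0) A₀ B₀ C₀) (h₁ : L.LimitsAlong atTop A₁ B₁ C₁)
    (hdet : C₁ / B₁ < C₀ / B₀) : ∃ M : Plane, L.line₀ ∩ L.lineInf = {M} := by
  have hB₀ := h₀.neg.ne
  have hB₁ := h₁.neg.ne
  have hd : B₀ * C₁ - B₁ * C₀ ≠ 0 := fun h ↦ hdet.ne (by field_simp; linarith)
  refine ⟨!₂[(C₀ * A₁ - C₁ * A₀) / (B₀ * C₁ - B₁ * C₀),
    (B₁ * A₀ - B₀ * A₁) / (B₀ * C₁ - B₁ * C₀)], ?_⟩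
  ext z
  simp only [line₀, lineInf, Set.mem_inter_iff, Set.mem_ofPred_eq, h₀.F₀_eq, h₁.Finf_eq,
    Set.mem_singleton_iff]
  constructor
  · rintro ⟨e₀, e₁⟩
    ext i
    fin_cases i
    · change z 0 = (C₀ * A₁ - C₁ * A₀) / (B₀ * C₁ - B₁ * C₀)
      rw [eq_div_iff hd]
      linear_combination C₁ * e₀ - C₀ * e₁
    · change z 1 = (B₁ * A₀ - B₀ * A₁) / (B₀ * C₁ - B₁ * C₀)
      rw [eq_div_iff hd]
      linear_combination B₀ * e₁ - B₁ * e₀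
  · rintro rfl
    simp only [Matrix.cons_val_zero, Matrix.cons_val_one]
    generalize hD : B₀ * C₁ - B₁ * C₀ = D at hd
    constructor <;> field_simp <;> rw [← hD] <;> ring

/-- The zeros of `F(·, z)` are counted by the winding number of the augmented envelope. -/
theorem exists_windingNumber (hL : L.IsRegular) {A₀ B₀ C₀ A₁ B₁ C₁ : ℝ}
    (h₀ : L.LimitsAlong (𝓝[>] 0) A₀ B₀ C₀) (h₁ : L.LimitsAlong atTop A₁ B₁ C₁)
    (hdet : C₁ / B₁ < C₀ / B₀) (hc₀ : ∃ e, Tendsto L.eta (𝓝[>] 0) (𝓝 e))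
    (hc₁ : (∃ e, Tendsto L.eta atTop (𝓝 e)) ∨ ∃ v, L.EscapesAlong atTop B₁ C₁ v)
    {z : Plane} (hz : z ∉ L.envelope ∪ L.line₀ ∪ L.lineInf) :
    ∃ M : Plane, L.line₀ ∩ L.lineInf = {M} ∧ ∃ w : ℤ,
      (∀ w' : ℤ, HasWindingNumber (L.augmentedEnvelope M) z w' ↔ w' = w) ∧
      {x | 0 < x ∧ L.F x z = 0}.encard =
        ((2 * w.natAbs + (L.quadrantH ∪ L.quadrantD).indicator (fun _ ↦ 1) z : ℕ) : ℕ∞) := by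
  simp only [Set.mem_union, not_or] at hz
  obtain ⟨⟨hzη, hz₀⟩, hz₁⟩ := hz
  obtain ⟨M, hM⟩ := exists_line₀_inter_lineInf h₀ h₁ hdet
  have hMm : M ∈ L.line₀ ∩ L.lineInf := hM ▸ rfl
  simp only [line₀, lineInf, Set.mem_inter_iff, Set.mem_ofPred_eq, h₀.F₀_eq, h₁.Finf_eq] at hMm hz₀ hz₁
  obtain ⟨θ, w, hθ, hdir, hw, hcos⟩ :=
    exists_angle hL h₀ h₁ hc₀ hc₁ hMm.1 hMm.2 hz₀ hz₁ hzη
  have hwind : HasWindingNumber (L.augmentedEnvelope M) z w := ⟨θ, hθ, hdir, hw⟩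
  refine ⟨M, hM, w, fun w' ↦ ⟨fun h ↦ hwind.unique h, fun h ↦ h ▸ hwind⟩, ?_⟩
  set α := L.frameAngle B₀ C₀ B₁ C₁ with hα
  set S := L.side A₀ B₀ C₀ A₁ B₁ C₁ z with hS
  set f₀ := A₀ + B₀ * z 0 + C₀ * z 1 with hf₀
  set f₁ := A₁ + B₁ * z 0 + C₁ * z 1 with hf₁
  have hψ : ContinuousOn (fun t ↦ θ t - α t) (Set.Icc (-1) 2) :=
    hθ.sub (continuousOn_frameAngle hL h₀ h₁)
  have hSle : ∀ t, t ≤ 0 → S t = f₀ := by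
    intro t ht
    rcases ht.lt_or_eq with h | rfl
    · rw [hS, side, glue_of_neg h]
    · rw [hS, side, glue_zero]
  have hSmid : ∀ t ∈ Set.Ioo (0 : ℝ) 1, S t = L.F (t / (1 - t)) z := fun t ht ↦ by
    rw [hS, side, glue_of_mem ht]
  have hSgt : ∀ t, 1 < t → S t = f₁ := fun t ht ↦ by rw [hS, side, glue_of_one_lt ht]
  have hzero : ∀ t ∈ Set.Icc (-1 : ℝ) 2, t ≠ 1 → (Real.cos (θ t - α t) = 0 ↔ S t = 0) := by
    intro t ht h1
    obtain ⟨r, hr, h⟩ := hcos t ht h1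
    rw [h, mul_eq_zero, or_iff_right hr.ne']
  -- beyond `t₁`, the sign of `F(x, z)` is constant
  obtain ⟨t₁, ht₁, hF₁⟩ : ∃ t₁ ∈ Set.Ioo (0 : ℝ) 1, ∀ t ∈ Set.Ico t₁ 1,
      0 < L.F (t / (1 - t)) z * f₁ := by
    have h1 : ∀ᶠ x in atTop, 0 < L.F x z * f₁ := by
      have h2 : ∀ᶠ x in atTop, 0 < L.scale x * L.F x z * f₁ :=
        ((h₁.tendsto_F z).mul_const f₁).eventually_const_lt (mul_self_pos.2 hz₁)
      filter_upwards [h2, eventually_gt_atTop 0] with x hx hx0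
      rw [mul_assoc] at hx
      exact (mul_pos_iff_of_pos_left (hL.scale_pos x hx0)).1 hx
    obtain ⟨t₁, ht₁, h⟩ :=
      mem_nhdsLT_iff_exists_Ico_subset.1 (tendsto_div_one_sub.eventually h1)
    -- The value `1 / 2` only makes `t₁` positive.
    refine ⟨max t₁ (1 / 2), ⟨by positivity, max_lt ht₁ (by norm_num)⟩, fun t ht ↦ ?_⟩
    exact h ⟨(le_max_left _ _).trans ht.1, ht.2⟩
  -- At such a `t` the point `z` lies on `ℓ_x` but is not its contact point. The clockwise turn
  -- makes `sin (ψ t) * F` decrease through zero, which is an upward passage of `ψ = θ - α`.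
  have hcr : ∀ t ∈ Set.Ioo (-1) t₁, Real.cos (θ t - α t) = 0 →
      (∀ᶠ s in 𝓝[>] t, θ t - α t < θ s - α s) ∧ ∀ᶠ s in 𝓝[<] t, θ s - α s < θ t - α t := by
    intro t ht hct
    have htI : t ∈ Set.Ioo (-1 : ℝ) 2 := ⟨ht.1, by linarith [ht.2, ht₁.2]⟩
    have hψt : ContinuousAt (fun t ↦ θ t - α t) t := hψ.continuousAt (Icc_mem_nhds htI.1 htI.2)
    have ht1 : t < 1 := ht.2.trans ht₁.2
    have hSt : S t = 0 := (hzero t ⟨htI.1.le, htI.2.le⟩ ht1.ne).1 hct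
    have ht0 : 0 < t := by
      by_contra! h
      exact hz₀ ((hSle t h).symm.trans hSt)
    have hx : 0 < t / (1 - t) := div_pos ht0 (sub_pos.2 ht1)
    have hFt : L.F (t / (1 - t)) z = 0 := (hSmid t ⟨ht0, ht1⟩).symm.trans hSt
    have hη := hL.eta_spec hx
    have hηz : L.eta (t / (1 - t)) - z ≠ 0 := fun h ↦
      hzη (sub_eq_zero.1 h ▸ hL.eta_mem_envelope hx)
    have hθt : dir (L.eta (t / (1 - t)) - z) = !₂[Real.cos (θ t), Real.sin (θ t)] := by
      rw [← augmentedEnvelope_of_mem (M := M) ⟨ht0, ht1⟩]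
      exact (hdir t ⟨htI.1.le, htI.2.le⟩ ht0.ne' ht1.ne).2
    have hsin := sin_sub_arctan_mul_neg (hL.b_neg _ hx) (hL.wronskian_neg _ hx) hηz
      hη.1 hη.2 hFt hθt
    have hαt : α t = Real.arctan (L.c (t / (1 - t)) / L.b (t / (1 - t))) := by
      rw [hα, frameAngle, glue_of_mem ⟨ht0, ht1⟩]
    rw [← hαt] at hsin
    have hder : HasDerivAt (fun s ↦ Real.sin (θ t - α t) * L.F (s / (1 - s)) z)
        (Real.sin (θ t - α t) * ((deriv L.a (t / (1 - t)) + deriv L.b (t / (1 - t)) * z 0 +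
          deriv L.c (t / (1 - t)) * z 1) * (1 / (1 - t) ^ 2))) t :=
      ((hL.hasDerivAt_F hx z).comp t (hasDerivAt_div_one_sub ht1)).const_mul _
    have hneg : Real.sin (θ t - α t) * ((deriv L.a (t / (1 - t)) + deriv L.b (t / (1 - t)) * z 0 +
          deriv L.c (t / (1 - t)) * z 1) * (1 / (1 - t) ^ 2)) < 0 := by
      rw [← mul_assoc]
      exact mul_neg_of_neg_of_pos hsin (by have := sub_pos.2 ht1; positivity)
    obtain ⟨hR, hLf⟩ := eventually_neg_pos_of_deriv_neg hder hneg (by rw [hFt, mul_zero])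
    have hnear : ∀ᶠ s in 𝓝 t, s ∈ Set.Ioo (0 : ℝ) 1 := Ioo_mem_nhds ht0 ht1
    have hcs : ∀ s ∈ Set.Ioo (0 : ℝ) 1, ∃ r, 0 < r ∧ Real.sin (θ t - α t) * Real.cos (θ s - α s) =
        r * (Real.sin (θ t - α t) * L.F (s / (1 - s)) z) := by
      intro s hs
      obtain ⟨r, hr, h⟩ := hcos s ⟨by linarith [hs.1], by linarith [hs.2]⟩ hs.2.ne
      refine ⟨r, hr, ?_⟩
      rw [h, hSmid s hs]
      ring
    constructor
    · refine eventually_lt_of_sin_mul_cos (ψ := fun t ↦ θ t - α t)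
        (hψt.tendsto.mono_left nhdsWithin_le_nhds) hct ?_
      filter_upwards [hR, nhdsWithin_le_nhds hnear] with s hs hs1
      obtain ⟨r, hr, h⟩ := hcs s hs1
      rw [h]
      exact mul_neg_of_pos_of_neg hr hs
    · refine eventually_gt_of_sin_mul_cos (ψ := fun t ↦ θ t - α t)
        (hψt.tendsto.mono_left nhdsWithin_le_nhds) hct ?_
      filter_upwards [hLf, nhdsWithin_le_nhds hnear] with s hs hs1
      obtain ⟨r, hr, h⟩ := hcs s hs1
      rw [h]
      exact mul_pos hr hs
  obtain ⟨r₀, hr₀, hcos₀⟩ := hcos (-1) ⟨le_rfl, by norm_num⟩ (by norm_num)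
  obtain ⟨r₁, hr₁, hcos₁⟩ := hcos 2 ⟨by norm_num, le_rfl⟩ (by norm_num)
  rw [hSle _ (by norm_num)] at hcos₀
  rw [hSgt _ (by norm_num)] at hcos₁
  have hsgn : ∀ t ∈ Set.Icc t₁ 2, t ≠ 1 →
      0 < Real.cos (θ t - α t) * Real.cos (θ 2 - α 2) := by
    intro t ht h1
    obtain ⟨r, hr, h⟩ := hcos t ⟨by linarith [ht.1, ht₁.1], ht.2⟩ h1
    rw [h, hcos₁]
    have h2 : 0 < S t * f₁ := by
      rcases lt_or_gt_of_ne h1 with h1 | h1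
      · rw [hSmid t ⟨ht₁.1.trans_le ht.1, h1⟩]
        exact hF₁ t ⟨ht.1, h1⟩
      · rw [hSgt t h1]
        exact mul_self_pos.2 hz₁
    calc 0 < r * r₁ * (S t * f₁) := by positivity
      _ = _ := by ring
  have hα₀ : α (-1) = Real.arctan (C₀ / B₀) := by
    rw [hα, frameAngle, glue_of_neg (by norm_num)]
  have hα₁ : α 2 = Real.arctan (C₁ / B₁) := by
    rw [hα, frameAngle, glue_of_one_lt (by norm_num)]
  -- The frame contributes `D = arctan (C₀ / B₀) - arctan (C₁ / B₁)`, positive by `hdet` and less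
  -- than `π` by the range of `arctan`.
  have hcount := encard_cos_zeros_eq_two_mul_natAbs (ψ := fun t ↦ θ t - α t)
    (D := α (-1) - α 2) (w := w) (by linarith [ht₁.1]) ht₁.2 one_lt_two hψ
    (by rw [hcos₀]; exact mul_ne_zero hr₀.ne' hz₀) hcr hsgn
    (by rw [hα₀, hα₁]; exact sub_pos.2 (Real.arctan_strictMono hdet))
    (by rw [hα₀, hα₁]; linarith [Real.arctan_lt_pi_div_two (C₀ / B₀),
          Real.neg_pi_div_two_lt_arctan (C₁ / B₁)])
    (by linarith)
  -- No zero is gained or lost: on `(-1, 0]` the side function is the nonzero constant `f₀`, and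
  -- from `t₁` on `F(·, z)` has no zero. The inverse parametrization is `x / (1 + x)`.
  have himg : (fun t : ℝ ↦ t / (1 - t)) ''
      {t | t ∈ Set.Ioo (-1) t₁ ∧ Real.cos (θ t - α t) = 0} = {x | 0 < x ∧ L.F x z = 0} := by
    ext x
    constructor
    · rintro ⟨t, ⟨ht, hct⟩, rfl⟩
      have ht1 : t < 1 := ht.2.trans ht₁.2
      have hSt : S t = 0 := (hzero t ⟨ht.1.le, by linarith⟩ ht1.ne).1 hct
      have ht0 : 0 < t := by
        by_contra! h
        exact hz₀ ((hSle t h).symm.trans hSt)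
      exact ⟨div_pos ht0 (sub_pos.2 ht1), (hSmid t ⟨ht0, ht1⟩).symm.trans hSt⟩
    · rintro ⟨hx, hFx⟩
      have h1x : 0 < 1 + x := by linarith
      have ht0 : 0 < x / (1 + x) := div_pos hx h1x
      have ht1 : x / (1 + x) < 1 := (div_lt_one h1x).2 (by linarith)
      have hxx : x / (1 + x) / (1 - x / (1 + x)) = x := by
        field_simp
        ring
      have hlt : x / (1 + x) < t₁ := by
        by_contra! h
        have := hF₁ _ ⟨h, ht1⟩
        rw [hxx, hFx, zero_mul] at this
        exact lt_irrefl _ this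
      refine ⟨x / (1 + x), ⟨⟨by linarith, hlt⟩, ?_⟩, hxx⟩
      rw [hzero _ ⟨by linarith, by linarith⟩ ht1.ne, hSmid _ ⟨ht0, ht1⟩, hxx, hFx]
  have hinj : Set.InjOn (fun t : ℝ ↦ t / (1 - t))
      {t | t ∈ Set.Ioo (-1) t₁ ∧ Real.cos (θ t - α t) = 0} := by
    rintro s ⟨hs, -⟩ t ⟨ht, -⟩ hst
    have h1 : 1 - s ≠ 0 := by linarith [hs.2, ht₁.2]
    have h2 : 1 - t ≠ 0 := by linarith [ht.2, ht₁.2]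
    simp only at hst
    rw [div_eq_div_iff h1 h2] at hst
    linarith
  rw [← himg, hinj.encard_image, hcount]
  congr 2
  rw [hcos₀, hcos₁]
  have hiff : r₀ * f₀ * (r₁ * f₁) < 0 ↔ z ∈ L.quadrantH ∪ L.quadrantD := by
    rw [show r₀ * f₀ * (r₁ * f₁) = (r₀ * r₁) * (f₀ * f₁) by ring,
      ← not_le, mul_nonneg_iff_of_pos_left (mul_pos hr₀ hr₁), not_le, mul_neg_iff]
    simp only [quadrantH, quadrantD, Set.mem_union, Set.mem_ofPred_eq, h₀.F₀_eq, h₁.Finf_eq,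
      ← hf₀, ← hf₁]
  by_cases h : r₀ * f₀ * (r₁ * f₁) < 0
  · rw [if_pos h, Set.indicator_of_mem (hiff.1 h)]
  · rw [if_neg h, Set.indicator_of_notMem (fun h' ↦ h (hiff.2 h'))]

end LineFamily

/-! ### Families of lines given by a kernel `m(x, λ)`. -/

theorem wronskian_eq {f g : ℝ → ℝ} {f' g' x : ℝ} (hf : HasDerivAt f f' x) (hg : HasDerivAt g g' x) :
    LineFamily.wronskian f g x = f x * g' - g x * f' := by
  rw [LineFamily.wronskian, hf.deriv, hg.deriv]

/-- The Wronskian of `m(·, λ)` and `m(·, μ)`, where `m'` is the derivative of `m`. -/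
def kernelWronskian (m m' : ℝ → ℝ → ℝ) (x l μ : ℝ) : ℝ := m x l * m' x μ - m x μ * m' x l

theorem tendsto_plane {α : Type*} {l : Filter α} {f g : α → ℝ} {a b : ℝ} (hf : Tendsto f l (𝓝 a))
    (hg : Tendsto g l (𝓝 b)) : Tendsto (fun y ↦ (!₂[f y, g y] : Plane)) l (𝓝 !₂[a, b]) := by
  refine ((PiLp.continuous_toLp 2 (fun _ : Fin 2 ↦ ℝ)).tendsto ![a, b]).comp
    (tendsto_pi_nhds.2 fun i ↦ ?_)
  fin_cases i
  · exact hf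
  · exact hg

namespace LineFamily

variable {L : LineFamily}

/-- Convergence of the (rescaled) envelope. -/
theorem tendsto_smul_eta {l : Filter ℝ} {τ s : ℝ → ℝ} {n₀ n₁ d : ℝ} (hd : d ≠ 0)
    (hs : ∀ᶠ x in l, s x ≠ 0)
    (h₀ : Tendsto (fun x ↦ τ x * s x * wronskian L.c L.a x) l (𝓝 n₀))
    (h₁ : Tendsto (fun x ↦ τ x * s x * wronskian L.a L.b x) l (𝓝 n₁))
    (h : Tendsto (fun x ↦ s x * wronskian L.b L.c x) l (𝓝 d)) :
    Tendsto (fun x ↦ τ x • L.eta x) l (𝓝 !₂[n₀ / d, n₁ / d]) := by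
  refine (tendsto_plane (h₀.div h hd) (h₁.div h hd)).congr' ?_
  filter_upwards [hs] with x hx
  have key : ∀ y, τ x * s x * y / (s x * wronskian L.b L.c x) = τ x * (y / wronskian L.b L.c x) := by
    intro y
    rw [mul_comm (τ x), mul_assoc, mul_div_mul_left _ _ hx, mul_div_assoc]
  ext i
  fin_cases i
  · exact key _
  · exact key _

/-- The envelope escapes in the second coordinate direction. -/
theorem escapesAlong_of_tendsto {l : Filter ℝ} {τ : ℝ → ℝ} {κ B : ℝ} (hκ : 0 < κ)
    (hτ : Tendsto τ l (𝓝[>] 0)) (h : Tendsto (fun x ↦ τ x • L.eta x) l (𝓝 !₂[0, κ])) :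
    L.EscapesAlong l B 0 !₂[0, 1] := by
  have hne : (!₂[0, κ] : Plane) ≠ 0 := fun h0 ↦ hκ.ne' (by simpa using congrArg (fun v : Plane ↦ v 1) h0)
  have hnorm : ‖(!₂[0, κ] : Plane)‖ = κ := by
    rw [EuclideanSpace.norm_eq, Fin.sum_univ_two]
    simp [hκ.le]
  have hpos : ∀ᶠ x in l, 0 < τ x := hτ.eventually self_mem_nhdsWithin
  refine ⟨?_, by simp, ?_, ?_⟩
  · rw [EuclideanSpace.norm_eq, Fin.sum_univ_two]
    simp
  · have h1 := (tendsto_inv_nhdsGT_zero.comp hτ).atTop_mul_pos (C := κ) hκ (hnorm ▸ h.norm)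
    refine h1.congr' ?_
    filter_upwards [hpos] with x hx
    rw [Function.comp_apply, norm_smul, Real.norm_of_nonneg hx.le, ← mul_assoc,
      inv_mul_cancel₀ hx.ne', one_mul]
  · have h1 := (continuousAt_dir hne).tendsto.comp h
    have h2 : dir (!₂[0, κ] : Plane) = !₂[0, 1] := by
      rw [dir, hnorm]
      ext i
      fin_cases i
      · simp
      · simp [hκ.ne']
    rw [h2] at h1
    refine h1.congr' ?_
    filter_upwards [hpos] with x hx
    exact dir_smul hx _

end LineFamily

namespace Params

variable (p : Params)

/-- The exponents that occur in the operator `𝒜`. -/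
def IsExponent (μ : ℝ) : Prop :=
  μ = 2 * p.lam 0 ∨ μ = 2 * p.lam 1 ∨ μ = p.lam 0 + p.lam 1 ∨ μ = p.lam 0 ∨ μ = p.lam 1

variable {p}

theorem lam_one_pos : 0 < p.lam 1 := p.lam_pos.trans p.lam_lt

theorem isExponent_zero : p.IsExponent (p.lam 0) := Or.inr (Or.inr (Or.inr (Or.inl rfl)))

theorem isExponent_one : p.IsExponent (p.lam 1) := Or.inr (Or.inr (Or.inr (Or.inr rfl)))

/-- The slowest decay rate is `p.lam 0`; this is what the scalings at infinity are built on. -/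
theorem IsExponent.le {μ : ℝ} (h : p.IsExponent μ) : p.lam 0 ≤ μ := by
  have := p.lam_pos
  have := p.lam_lt
  rcases h with rfl | rfl | rfl | rfl | rfl <;> linarith

theorem IsExponent.pos {μ : ℝ} (h : p.IsExponent μ) : 0 < μ := p.lam_pos.trans_le h.le

/-- `𝒜` of an expression that depends on `λ` only. -/
noncomputable def opConst (p : Params) (k : ℝ → ℝ) : ℝ := p.opA (fun _ l ↦ k l) 0

/-- `opA` is a linear combination over five exponents with coefficients independent of `m` and `x`,
so limits can be checked one exponent at a time. -/
theorem tendsto_opA {m : ℝ → ℝ → ℝ} {k : ℝ → ℝ} {f : Filter ℝ}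
    (h : ∀ μ, p.IsExponent μ → Tendsto (fun x ↦ m x μ) f (𝓝 (k μ))) :
    Tendsto (p.opA m) f (𝓝 (p.opConst k)) := by
  have h1 := h (2 * p.lam 0) (Or.inl rfl)
  have h2 := h (2 * p.lam 1) (Or.inr (Or.inl rfl))
  have h3 := h (p.lam 0 + p.lam 1) (Or.inr (Or.inr (Or.inl rfl)))
  exact (((((h1.const_mul _).add (h2.const_mul _)).add (h3.const_mul _)).add
    ((h _ isExponent_zero).const_mul _)).add ((h _ isExponent_one).const_mul _)).neg

theorem hasDerivAt_opA {m m' : ℝ → ℝ → ℝ} {x : ℝ}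
    (h : ∀ μ, 0 < μ → HasDerivAt (fun y ↦ m y μ) (m' x μ) x) :
    HasDerivAt (p.opA m) (p.opA m' x) x := by
  have h0 := p.lam_pos
  have h1 := p.lam_one_pos
  exact ((((((h (2 * p.lam 0) (by linarith)).const_mul _).add
    ((h (2 * p.lam 1) (by linarith)).const_mul _)).add
    ((h (p.lam 0 + p.lam 1) (by linarith)).const_mul _)).add
    ((h _ h0).const_mul _)).add ((h _ h1).const_mul _)).neg

theorem mul_opA (s : ℝ → ℝ) (m : ℝ → ℝ → ℝ) (x : ℝ) :
    s x * p.opA m x = p.opA (fun y μ ↦ s y * m y μ) x := by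
  simp only [opA]; ring

/-- The family of lines with kernel `m`. -/
noncomputable def kernelFamily (p : Params) (m : ℝ → ℝ → ℝ) (s : ℝ → ℝ) : LineFamily where
  a := p.opA m
  b := fun x ↦ m x (p.lam 0)
  c := fun x ↦ m x (p.lam 1)
  scale := s

section Kernel

variable {m m' : ℝ → ℝ → ℝ} {s : ℝ → ℝ} {x : ℝ}

theorem wronskian_b_c (h : ∀ μ, 0 < μ → HasDerivAt (fun y ↦ m y μ) (m' x μ) x) :
    LineFamily.wronskian (p.kernelFamily m s).b (p.kernelFamily m s).c x =
      kernelWronskian m m' x (p.lam 0) (p.lam 1) :=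
  wronskian_eq (h _ p.lam_pos) (h _ lam_one_pos)

/-- Since `a` is `opA` of the kernel and the Wronskian is bilinear, the numerators of `η` are `opA`
of Wronskians of two kernel functions. -/
theorem wronskian_c_a (h : ∀ μ, 0 < μ → HasDerivAt (fun y ↦ m y μ) (m' x μ) x) :
    LineFamily.wronskian (p.kernelFamily m s).c (p.kernelFamily m s).a x =
      p.opA (fun x μ ↦ kernelWronskian m m' x (p.lam 1) μ) x := by
  refine (wronskian_eq (h _ lam_one_pos) (hasDerivAt_opA h)).trans ?_
  simp only [opA, kernelWronskian]
  ring

theorem wronskian_a_b (h : ∀ μ, 0 < μ → HasDerivAt (fun y ↦ m y μ) (m' x μ) x) :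
    LineFamily.wronskian (p.kernelFamily m s).a (p.kernelFamily m s).b x =
      p.opA (fun x μ ↦ kernelWronskian m m' x μ (p.lam 0)) x := by
  refine (wronskian_eq (hasDerivAt_opA h) (h _ p.lam_pos)).trans ?_
  simp only [opA, kernelWronskian]
  ring

theorem limitsAlong_kernelFamily {f : Filter ℝ} {k : ℝ → ℝ}
    (h : ∀ μ, p.IsExponent μ → Tendsto (fun x ↦ s x * m x μ) f (𝓝 (k μ)))
    (hneg : k (p.lam 0) < 0) :
    (p.kernelFamily m s).LimitsAlong f (p.opConst k) (k (p.lam 0)) (k (p.lam 1)) where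
  tendsto_a := (tendsto_opA h).congr fun x ↦ (mul_opA s m x).symm
  tendsto_b := h _ isExponent_zero
  tendsto_c := h _ isExponent_one
  neg := hneg

/-- The rescaled envelope of a family of lines given by a kernel. -/
theorem tendsto_smul_eta_kernelFamily {f : Filter ℝ} {τ σ : ℝ → ℝ} {k₀ k₁ : ℝ → ℝ} {d : ℝ}
    (hd : d ≠ 0) (hf : ∀ᶠ x in f, 0 < x) (hσ : ∀ x, 0 < x → σ x ≠ 0)
    (hm : ∀ x, 0 < x → ∀ μ, 0 < μ → HasDerivAt (fun y ↦ m y μ) (m' x μ) x)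
    (h₀ : ∀ μ, p.IsExponent μ →
      Tendsto (fun x ↦ τ x * σ x * kernelWronskian m m' x (p.lam 1) μ) f (𝓝 (k₀ μ)))
    (h₁ : ∀ μ, p.IsExponent μ →
      Tendsto (fun x ↦ τ x * σ x * kernelWronskian m m' x μ (p.lam 0)) f (𝓝 (k₁ μ)))
    (h : Tendsto (fun x ↦ σ x * kernelWronskian m m' x (p.lam 0) (p.lam 1)) f (𝓝 d)) :
    Tendsto (fun x ↦ τ x • (p.kernelFamily m s).eta x) f
      (𝓝 !₂[p.opConst k₀ / d, p.opConst k₁ / d]) := by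
  refine LineFamily.tendsto_smul_eta (s := σ) hd (hf.mono hσ) ?_ ?_ ?_
  · refine (tendsto_opA h₀).congr' ?_
    filter_upwards [hf] with x hx
    rw [wronskian_c_a (hm x hx), mul_opA (fun x ↦ τ x * σ x)]
  · refine (tendsto_opA h₁).congr' ?_
    filter_upwards [hf] with x hx
    rw [wronskian_a_b (hm x hx), mul_opA (fun x ↦ τ x * σ x)]
  · refine h.congr' ?_
    filter_upwards [hf] with x hx
    rw [wronskian_b_c (hm x hx)]

/-- For the cases where one scaling `σ` serves numerators and denominator at once. -/
theorem exists_tendsto_eta_kernelFamily {f : Filter ℝ} {σ : ℝ → ℝ} {k : ℝ → ℝ → ℝ}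
    (hd : k (p.lam 0) (p.lam 1) ≠ 0) (hf : ∀ᶠ x in f, 0 < x) (hσ : ∀ x, 0 < x → σ x ≠ 0)
    (hm : ∀ x, 0 < x → ∀ μ, 0 < μ → HasDerivAt (fun y ↦ m y μ) (m' x μ) x)
    (h : ∀ l μ, p.IsExponent l → p.IsExponent μ →
      Tendsto (fun x ↦ σ x * kernelWronskian m m' x l μ) f (𝓝 (k l μ))) :
    ∃ e, Tendsto (p.kernelFamily m s).eta f (𝓝 e) := by
  have := tendsto_smul_eta_kernelFamily (p := p) (s := s) (τ := fun _ ↦ 1) hd hf hσ hm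
    (fun μ hμ ↦ by simpa using h _ μ isExponent_one hμ)
    (fun μ hμ ↦ by simpa using h μ _ hμ isExponent_zero) (h _ _ isExponent_zero isExponent_one)
  exact ⟨_, by simpa using this⟩

theorem isRegular_kernelFamily (hs : ∀ x, 0 < x → 0 < s x)
    (hm : ∀ μ, 0 < μ → ContDiffOn ℝ 1 (fun x ↦ m x μ) (Set.Ioi 0))
    (hm' : ∀ x, 0 < x → ∀ μ, 0 < μ → HasDerivAt (fun y ↦ m y μ) (m' x μ) x)
    (hneg : ∀ x, 0 < x → m x (p.lam 0) < 0)
    (hW : ∀ x, 0 < x → kernelWronskian m m' x (p.lam 0) (p.lam 1) < 0) :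
    (p.kernelFamily m s).IsRegular where
  scale_pos := hs
  contDiffOn_a := by
    have h0 := p.lam_pos
    have h1 := p.lam_one_pos
    exact (((((contDiffOn_const.mul (hm (2 * p.lam 0) (by linarith))).add
      (contDiffOn_const.mul (hm (2 * p.lam 1) (by linarith)))).add
      (contDiffOn_const.mul (hm (p.lam 0 + p.lam 1) (by linarith)))).add
      (contDiffOn_const.mul (hm _ h0))).add (contDiffOn_const.mul (hm _ h1))).neg
  contDiffOn_b := hm _ p.lam_pos
  contDiffOn_c := hm _ lam_one_pos
  b_neg := hneg
  wronskian_neg x hx := by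
    rw [wronskian_b_c (hm' x hx)]
    exact hW x hx

end Kernel

end Params

/-! ### The forward curve. -/

namespace Params

variable {p : Params}

theorem family_forward :
    p.family .forward = p.kernelFamily mForward (fun x ↦ Real.exp (p.lam 0 * x)) := rfl

theorem hasDerivAt_mForward (x μ : ℝ) :
    HasDerivAt (fun y ↦ mForward y μ) (μ ^ 2 * Real.exp (-μ * x)) x := by
  have h := (((hasDerivAt_id x).const_mul (-μ)).exp).const_mul (-μ)
  refine h.congr_deriv ?_
  simp only [id]
  ring

/-- The factor `l - μ` gives the sense of rotation of the lines, the rate `l + μ` the asymptotics of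
the envelope. -/
theorem kernelWronskian_mForward (x l μ : ℝ) :
    kernelWronskian mForward (fun x μ ↦ μ ^ 2 * Real.exp (-μ * x)) x l μ =
      l * μ * (l - μ) * Real.exp (-(l + μ) * x) := by
  rw [kernelWronskian, mForward, mForward, show -(l + μ) * x = -l * x + -μ * x by ring,
    Real.exp_add]
  ring

theorem isRegular_forward : (p.family .forward).IsRegular := by
  refine isRegular_kernelFamily (m' := fun x μ ↦ μ ^ 2 * Real.exp (-μ * x))
    (fun x _ ↦ Real.exp_pos _) (fun μ _ ↦ ?_)
    (fun x _ μ _ ↦ hasDerivAt_mForward x μ) (fun x _ ↦ ?_) fun x _ ↦ ?_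
  · unfold mForward
    fun_prop
  · exact mul_neg_of_neg_of_pos (neg_neg_of_pos p.lam_pos) (Real.exp_pos _)
  · rw [kernelWronskian_mForward]
    exact mul_neg_of_neg_of_pos (mul_neg_of_pos_of_neg (mul_pos p.lam_pos lam_one_pos)
      (sub_neg.2 p.lam_lt)) (Real.exp_pos _)

theorem tendsto_const_mul_exp_atTop {c ν : ℝ} (h : c = 0 ∨ 0 < ν) :
    Tendsto (fun x ↦ c * Real.exp (-ν * x)) atTop (𝓝 0) := by
  rcases h with rfl | h
  · simp
  · have h1 : Tendsto (fun x : ℝ ↦ ν * x) atTop atTop := tendsto_id.const_mul_atTop h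
    have := (Real.tendsto_exp_neg_atTop_nhds_zero.comp h1).const_mul c
    simpa [Function.comp_def] using this

theorem limitsAlong_forward_zero : (p.family .forward).LimitsAlong (𝓝[>] 0)
    (p.opConst fun μ ↦ -μ) (-p.lam 0) (-p.lam 1) := by
  refine limitsAlong_kernelFamily (k := fun μ ↦ -μ) (fun μ _ ↦ ?_) (neg_neg_of_pos p.lam_pos)
  have h : Continuous fun x : ℝ ↦ Real.exp (p.lam 0 * x) * mForward x μ := by
    unfold mForward
    fun_prop
  have := (h.tendsto 0).mono_left (nhdsWithin_le_nhds (s := Set.Ioi 0))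
  simpa [mForward] using this

open Classical in
/-- The limit of `e^{λ₁ x} m_f(x, μ)` as `x → ∞`. -/
noncomputable def forwardLimit (p : Params) (μ : ℝ) : ℝ := if μ = p.lam 0 then -p.lam 0 else 0

/-- After scaling, the decay rate is `μ - p.lam 0`, so only the slowest exponent survives. -/
theorem tendsto_forwardLimit {μ : ℝ} (hμ : p.lam 0 ≤ μ) :
    Tendsto (fun x ↦ Real.exp (p.lam 0 * x) * mForward x μ) atTop (𝓝 (p.forwardLimit μ)) := by
  have h : ∀ x, Real.exp (p.lam 0 * x) * mForward x μ = -μ * Real.exp (-(μ - p.lam 0) * x) := by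
    intro x
    rw [mForward, show -(μ - p.lam 0) * x = p.lam 0 * x + -μ * x by ring, Real.exp_add]
    ring
  simp_rw [h]
  rw [forwardLimit]
  split_ifs with h0
  · subst h0; simp
  · exact tendsto_const_mul_exp_atTop (Or.inr (sub_pos.2 (lt_of_le_of_ne hμ (Ne.symm h0))))

theorem forwardLimit_zero : p.forwardLimit (p.lam 0) = -p.lam 0 := if_pos rfl

theorem forwardLimit_one : p.forwardLimit (p.lam 1) = 0 := if_neg p.lam_lt.ne'

theorem limitsAlong_forward_atTop : (p.family .forward).LimitsAlong atTop
    (p.opConst p.forwardLimit) (-p.lam 0) 0 := by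
  have := limitsAlong_kernelFamily (p := p) (fun μ hμ ↦ tendsto_forwardLimit hμ.le)
    (by rw [forwardLimit_zero]; exact neg_neg_of_pos p.lam_pos)
  rwa [forwardLimit_zero, forwardLimit_one] at this

theorem kernelWronskian_forward_ne : p.lam 0 * p.lam 1 * (p.lam 0 - p.lam 1) ≠ 0 :=
  mul_ne_zero (mul_pos p.lam_pos lam_one_pos).ne' (sub_neg.2 p.lam_lt).ne

theorem exists_tendsto_eta_forward_zero :
    ∃ e, Tendsto (p.family .forward).eta (𝓝[>] 0) (𝓝 e) := by
  refine exists_tendsto_eta_kernelFamily (σ := fun _ ↦ 1) (k := fun l μ ↦ l * μ * (l - μ))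
    kernelWronskian_forward_ne self_mem_nhdsWithin (fun _ _ ↦ one_ne_zero)
    (fun x _ μ _ ↦ hasDerivAt_mForward x μ) fun l μ _ _ ↦ ?_
  simp_rw [kernelWronskian_mForward]
  have h : Continuous fun x : ℝ ↦ 1 * (l * μ * (l - μ) * Real.exp (-(l + μ) * x)) := by fun_prop
  have := (h.tendsto 0).mono_left (nhdsWithin_le_nhds (s := Set.Ioi 0))
  simpa using this

theorem exp_mul_kernelWronskian_mForward (ν x l μ : ℝ) :
    Real.exp (ν * x) * kernelWronskian mForward (fun x μ ↦ μ ^ 2 * Real.exp (-μ * x)) x l μ =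
      l * μ * (l - μ) * Real.exp (-(l + μ - ν) * x) := by
  rw [kernelWronskian_mForward, show -(l + μ - ν) * x = ν * x + -(l + μ) * x by ring, Real.exp_add]
  ring

open Classical in
theorem tendsto_const_mul_exp_atTop_ite {c ν : ℝ} (h : c = 0 ∨ 0 ≤ ν) :
    Tendsto (fun x ↦ c * Real.exp (-ν * x)) atTop (𝓝 (if ν = 0 then c else 0)) := by
  split_ifs with h0
  · subst h0; simp
  · exact tendsto_const_mul_exp_atTop (h.imp_right fun h ↦ lt_of_le_of_ne h (Ne.symm h0))

/-- The envelope of the forward curve at infinity: it escapes if `2 λ₁ < λ₂`. -/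
theorem eta_forward_atTop : (∃ e, Tendsto (p.family .forward).eta atTop (𝓝 e)) ∨
    ∃ v, (p.family .forward).EscapesAlong atTop (-p.lam 0) 0 v := by
  classical
  have h0 := p.lam_pos
  have h1 := p.lam_lt
  have hd : Tendsto (fun x ↦ Real.exp ((p.lam 0 + p.lam 1) * x) * kernelWronskian mForward
      (fun x μ ↦ μ ^ 2 * Real.exp (-μ * x)) x (p.lam 0) (p.lam 1)) atTop
      (𝓝 (p.lam 0 * p.lam 1 * (p.lam 0 - p.lam 1))) := by
    simp_rw [exp_mul_kernelWronskian_mForward]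
    simp
  -- Relative to the denominator, the terms of the first coordinate decay at rates `μ - p.lam 0 ≥ 0`
  -- and those of the second at rates `μ - p.lam 1`. Below `p.lam 1` there can only be the exponents
  -- `p.lam 0`, whose coefficient vanishes, and `2 * p.lam 0`, which therefore decides.
  rcases le_or_gt (p.lam 1) (2 * p.lam 0) with hle | hlt
  · left
    have := tendsto_smul_eta_kernelFamily (p := p) (s := fun x ↦ Real.exp (p.lam 0 * x))
      (τ := fun _ ↦ 1)
      (k₀ := fun μ ↦ if p.lam 1 + μ - (p.lam 0 + p.lam 1) = 0 then
        p.lam 1 * μ * (p.lam 1 - μ) else 0)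
      (k₁ := fun μ ↦ if μ + p.lam 0 - (p.lam 0 + p.lam 1) = 0 then
        μ * p.lam 0 * (μ - p.lam 0) else 0)
      kernelWronskian_forward_ne (eventually_gt_atTop 0) (fun x _ ↦ (Real.exp_pos _).ne')
      (fun x _ μ _ ↦ hasDerivAt_mForward x μ) (fun μ hμ ↦ ?_) (fun μ hμ ↦ ?_) hd
    · exact ⟨_, by simpa [← family_forward] using this⟩
    · simp_rw [one_mul, exp_mul_kernelWronskian_mForward]
      exact tendsto_const_mul_exp_atTop_ite (Or.inr (by linarith [hμ.le]))
    · simp_rw [one_mul, exp_mul_kernelWronskian_mForward]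
      refine tendsto_const_mul_exp_atTop_ite ?_
      rcases hμ with rfl | rfl | rfl | rfl | rfl
      · right; linarith
      · right; linarith
      · right; linarith
      · left; ring
      · right; linarith
  · right
    -- This factor compensates exactly the growth of the dominant term, that of the exponent `2 *
    -- p.lam 0`.
    have hτ : Tendsto (fun x ↦ Real.exp ((2 * p.lam 0 - p.lam 1) * x)) atTop (𝓝[>] 0) := by
      refine tendsto_nhdsWithin_iff.2 ⟨?_, Eventually.of_forall fun x ↦ Real.exp_pos _⟩
      have := tendsto_const_mul_exp_atTop (c := 1) (ν := p.lam 1 - 2 * p.lam 0)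
        (Or.inr (by linarith))
      simpa using this
    have hτσ : ∀ x : ℝ, Real.exp ((2 * p.lam 0 - p.lam 1) * x) *
        Real.exp ((p.lam 0 + p.lam 1) * x) = Real.exp (3 * p.lam 0 * x) := by
      intro x
      rw [← Real.exp_add]
      ring_nf
    have := tendsto_smul_eta_kernelFamily (p := p) (s := fun x ↦ Real.exp (p.lam 0 * x))
      (τ := fun x ↦ Real.exp ((2 * p.lam 0 - p.lam 1) * x))
      (k₀ := fun μ ↦ 0)
      (k₁ := fun μ ↦ if μ + p.lam 0 - 3 * p.lam 0 = 0 then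
        μ * p.lam 0 * (μ - p.lam 0) else 0)
      kernelWronskian_forward_ne (eventually_gt_atTop 0) (fun x _ ↦ (Real.exp_pos _).ne')
      (fun x _ μ _ ↦ hasDerivAt_mForward x μ) (fun μ hμ ↦ ?_) (fun μ hμ ↦ ?_) hd
    · have hk₀ : p.opConst (fun _ ↦ 0) = 0 := by simp [opConst, opA]
      -- Only the exponent `2 * p.lam 0` contributes. Its contribution and the limit `d` of the
      -- denominator are both negative, so the envelope escapes in the positive second direction.
      have hk₁ : p.opConst (fun μ ↦ if μ + p.lam 0 - 3 * p.lam 0 = 0 then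
          μ * p.lam 0 * (μ - p.lam 0) else 0) = -(p.sig 0 ^ 2 * p.lam 0) := by
        rw [opConst, opA, if_pos (by ring), if_neg (by linarith), if_neg (by linarith),
          if_neg (by linarith), if_neg (by linarith)]
        field_simp
        ring
      rw [hk₀, hk₁, zero_div] at this
      have hs := p.sig_pos 0
      refine ⟨_, LineFamily.escapesAlong_of_tendsto (div_pos_of_neg_of_neg ?_ ?_) hτ this⟩
      · exact neg_neg_of_pos (by positivity)
      · exact mul_neg_of_pos_of_neg (mul_pos h0 lam_one_pos) (sub_neg.2 h1)
    · simp_rw [hτσ, exp_mul_kernelWronskian_mForward]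
      exact tendsto_const_mul_exp_atTop (Or.inr (by linarith [hμ.le]))
    · simp_rw [hτσ, exp_mul_kernelWronskian_mForward]
      refine tendsto_const_mul_exp_atTop_ite ?_
      rcases hμ with rfl | rfl | rfl | rfl | rfl
      · right; linarith
      · right; linarith
      · right; linarith
      · left; ring
      · right; linarith

end Params

/-! ### The yield curve. -/

namespace Params

variable {p : Params}

/-- The derivative of `m_y(·, μ)`. -/
noncomputable def mYield' (x μ : ℝ) : ℝ := (mForward x μ - 2 * mYield x μ) / x

theorem hasDerivAt_exp_mul_one_add (x μ : ℝ) :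
    HasDerivAt (fun y ↦ Real.exp (-μ * y) * (1 + μ * y) - 1) (-μ ^ 2 * x * Real.exp (-μ * x)) x := by
  have h1 := ((hasDerivAt_id x).const_mul (-μ)).exp
  have h2 := ((hasDerivAt_id x).const_mul μ).const_add 1
  refine ((h1.mul h2).sub_const 1).congr_deriv ?_
  simp only [id]
  ring

/-- The derivative of `x² m_y(x, μ)` is `x m_f(x, μ)`; the form of `mYield'` follows by the product
rule. -/
theorem hasDerivAt_mYield {x μ : ℝ} (hx : 0 < x) (hμ : 0 < μ) :
    HasDerivAt (fun y ↦ mYield y μ) (mYield' x μ) x := by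
  have h1 := ((hasDerivAt_id x).pow 2).const_mul μ
  have h0 : μ * id x ^ 2 ≠ 0 := by simp only [id]; positivity
  refine ((hasDerivAt_exp_mul_one_add x μ).div h1 h0).congr_deriv ?_
  rw [mYield', mForward, mYield]
  simp only [Pi.pow_apply, id]
  field_simp
  ring

/-- The part of `mYield'` proportional to `mYield` cancels by antisymmetry. -/
theorem kernelWronskian_mYield (x l μ : ℝ) :
    kernelWronskian mYield mYield' x l μ =
      (mYield x l * mForward x μ - mYield x μ * mForward x l) / x := by
  simp only [kernelWronskian, mYield']
  ring

theorem exp_mul_one_add_lt_one {y : ℝ} (hy : 0 < y) : Real.exp (-y) * (1 + y) < 1 := by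
  have h := Real.add_one_lt_exp hy.ne'
  calc Real.exp (-y) * (1 + y) < Real.exp (-y) * Real.exp y :=
        mul_lt_mul_of_pos_left (by linarith) (Real.exp_pos _)
    _ = 1 := by rw [← Real.exp_add, neg_add_cancel, Real.exp_zero]

theorem mYield_neg {x μ : ℝ} (hx : 0 < x) (hμ : 0 < μ) : mYield x μ < 0 := by
  have h := exp_mul_one_add_lt_one (mul_pos hμ hx)
  rw [← neg_mul] at h
  exact div_neg_of_neg_of_pos (by linarith) (by positivity)

/-- The function `(e^y - 1 - y) / y ^ 2` is increasing. -/
theorem sq_mul_exp_sub_lt {s c : ℝ} (hs : 0 < s) (hc : 1 < c) :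
    c ^ 2 * (Real.exp s - 1 - s) < Real.exp (c * s) - 1 - c * s := by
  have hder : ∀ y : ℝ, HasDerivAt
      (fun y ↦ (Real.exp (c * y) - 1 - c * y) - c ^ 2 * (Real.exp y - 1 - y))
      (c * (Real.exp (c * y) - 1 - c * (Real.exp y - 1))) y := by
    intro y
    have h1 := (((hasDerivAt_id y).const_mul c).exp.sub_const 1).sub ((hasDerivAt_id y).const_mul c)
    have h2 := (((Real.hasDerivAt_exp y).sub_const 1).sub (hasDerivAt_id y)).const_mul (c ^ 2)
    refine (h1.sub h2).congr_deriv ?_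
    simp only [id]
    ring
  have hmono : StrictMonoOn
      (fun y ↦ (Real.exp (c * y) - 1 - c * y) - c ^ 2 * (Real.exp y - 1 - y)) (Set.Ici 0) := by
    refine strictMonoOn_of_deriv_pos (convex_Ici 0)
      (fun y _ ↦ (hder y).continuousAt.continuousWithinAt) fun y hy ↦ ?_
    rw [interior_Ici] at hy
    rw [(hder y).deriv]
    have hy1 : 1 < Real.exp y := Real.one_lt_exp_iff.2 hy
    -- Bernoulli's inequality for `(1 + (e^y - 1))^c = e^(c y)` makes the derivative positive.
    have h := one_add_mul_self_lt_rpow_one_add (s := Real.exp y - 1) (by linarith)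
      (by linarith) hc
    rw [add_sub_cancel, ← Real.exp_mul, mul_comm y c] at h
    exact mul_pos (by linarith) (by linarith)
  have := hmono (Set.mem_Ici.2 le_rfl) (Set.mem_Ici.2 hs.le) hs
  simp only [mul_zero, Real.exp_zero] at this
  linarith

/-- Up to a positive factor, the sign is that of the difference of `(e^y - 1 - y) / y²` between `y =
p.lam 0 * x` and `y = p.lam 1 * x`, and this function is increasing. -/
theorem kernelWronskian_mYield_neg {x : ℝ} (hx : 0 < x) :
    kernelWronskian mYield mYield' x (p.lam 0) (p.lam 1) < 0 := by
  have h0 := p.lam_pos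
  have h1 := p.lam_one_pos
  have h := sq_mul_exp_sub_lt (mul_pos h0 hx) ((one_lt_div h0).2 p.lam_lt)
  have hc : p.lam 1 / p.lam 0 * (p.lam 0 * x) = p.lam 1 * x := by field_simp
  rw [hc, div_pow, div_mul_eq_mul_div, div_lt_iff₀ (by positivity)] at h
  have e0 : Real.exp (-p.lam 0 * x) * Real.exp (p.lam 0 * x) = 1 := by
    rw [← Real.exp_add]; simp
  have e1 : Real.exp (-p.lam 1 * x) * Real.exp (p.lam 1 * x) = 1 := by
    rw [← Real.exp_add]; simp
  rw [kernelWronskian_mYield]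
  refine div_neg_of_neg_of_pos ?_ hx
  have key : mYield x (p.lam 0) * mForward x (p.lam 1) - mYield x (p.lam 1) * mForward x (p.lam 0) =
      Real.exp (-p.lam 0 * x) * Real.exp (-p.lam 1 * x) / (p.lam 0 * p.lam 1 * x ^ 2) *
        (p.lam 1 ^ 2 * (Real.exp (p.lam 0 * x) - 1 - p.lam 0 * x) -
          (Real.exp (p.lam 1 * x) - 1 - p.lam 1 * x) * p.lam 0 ^ 2) := by
    rw [mYield, mYield, mForward, mForward]
    generalize Real.exp (-p.lam 0 * x) = E₀ at *
    generalize Real.exp (-p.lam 1 * x) = E₁ at *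
    generalize Real.exp (p.lam 1 * x) = G₁ at *
    field_simp
    linear_combination (-p.lam 1 ^ 2 * E₁) * e0 + (p.lam 0 ^ 2 * E₀) * e1
  rw [key]
  exact mul_neg_of_pos_of_neg (by positivity) (by linarith)

theorem isRegular_yield : (p.family .yield).IsRegular := by
  refine isRegular_kernelFamily (m' := mYield') (fun x _ ↦ by positivity) (fun μ hμ ↦ ?_)
    (fun x hx μ hμ ↦ hasDerivAt_mYield hx hμ) (fun x hx ↦ mYield_neg hx p.lam_pos)
    fun x hx ↦ kernelWronskian_mYield_neg hx
  refine ContDiffOn.div (by fun_prop) (by fun_prop) fun x hx ↦ ?_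
  have : 0 < x := hx
  positivity

theorem tendsto_one_sub_exp_div (μ : ℝ) :
    Tendsto (fun x ↦ (1 - Real.exp (-μ * x)) / x) (𝓝[>] 0) (𝓝 μ) := by
  have h1 : HasDerivAt (fun x ↦ 1 - Real.exp (-μ * x)) μ 0 := by
    refine ((((hasDerivAt_id (0 : ℝ)).const_mul (-μ)).exp).const_sub 1).congr_deriv ?_
    simp
  have h2 := h1.tendsto_slope.mono_left (nhdsWithin_mono 0 fun x (hx : 0 < x) ↦ hx.ne')
  refine h2.congr fun x ↦ ?_
  rw [slope_def_field]
  simp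

theorem tendsto_mForward_zero (μ : ℝ) :
    Tendsto (fun x ↦ (mForward x μ + μ) / x) (𝓝[>] 0) (𝓝 (μ ^ 2)) := by
  have := (tendsto_one_sub_exp_div μ).const_mul μ
  rw [← sq] at this
  refine this.congr fun x ↦ ?_
  rw [mForward]
  ring

/-- The first-order expansion `m_y = -μ/2 + μ² x / 3 + o(x)`. Over the denominator `μ x³`, a single
use of l'Hôpital's rule leaves the difference quotient of the exponential. -/
theorem tendsto_mYield_zero {μ : ℝ} (hμ : 0 < μ) :
    Tendsto (fun x ↦ (mYield x μ + μ / 2) / x) (𝓝[>] 0) (𝓝 (μ ^ 2 / 3)) := by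
  have hf : ∀ x, HasDerivAt
      (fun y ↦ (Real.exp (-μ * y) * (1 + μ * y) - 1) + μ ^ 2 / 2 * y ^ 2)
      (μ ^ 2 * x * (1 - Real.exp (-μ * x))) x := by
    intro x
    refine ((hasDerivAt_exp_mul_one_add x μ).add
      (((hasDerivAt_id x).pow 2).const_mul (μ ^ 2 / 2))).congr_deriv ?_
    simp only [id]
    ring
  have hg : ∀ x, HasDerivAt (fun y ↦ μ * y ^ 3) (3 * μ * x ^ 2) x := by
    intro x
    refine (((hasDerivAt_id x).pow 3).const_mul μ).congr_deriv ?_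
    simp only [id]
    push_cast
    ring
  have h := HasDerivAt.lhopital_zero_nhdsGT (l := 𝓝 (μ ^ 2 / 3))
    (Eventually.of_forall hf) (Eventually.of_forall hg)
    (by filter_upwards [self_mem_nhdsWithin] with x (hx : 0 < x); positivity)
    (by
      have := ((hf 0).continuousAt.tendsto).mono_left (nhdsWithin_le_nhds (s := Set.Ioi 0))
      simpa using this)
    (by
      have := ((hg 0).continuousAt.tendsto).mono_left (nhdsWithin_le_nhds (s := Set.Ioi 0))
      simpa using this)
    (by
      have := (tendsto_one_sub_exp_div μ).const_mul (μ / 3)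
      rw [show μ / 3 * μ = μ ^ 2 / 3 by ring] at this
      refine this.congr' ?_
      filter_upwards [self_mem_nhdsWithin] with x (hx : 0 < x)
      field_simp)
  refine h.congr' ?_
  filter_upwards [self_mem_nhdsWithin] with x (hx : 0 < x)
  rw [mYield]
  field_simp

/-- The constant terms of the two products in the Wronskian cancel. The first-order terms, divided
by `x`, give `l * μ * (l - μ) / 6`. -/
theorem exists_tendsto_eta_yield_zero :
    ∃ e, Tendsto (p.family .yield).eta (𝓝[>] 0) (𝓝 e) := by
  have h0 := p.lam_pos
  have h1 := p.lam_one_pos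
  refine exists_tendsto_eta_kernelFamily (σ := fun _ ↦ 1) (k := fun l μ ↦ l * μ * (l - μ) / 6)
    (div_ne_zero kernelWronskian_forward_ne (by norm_num)) self_mem_nhdsWithin
    (fun _ _ ↦ one_ne_zero) (fun x hx μ hμ ↦ hasDerivAt_mYield hx hμ) fun l μ hl hμ ↦ ?_
  have hid : Tendsto (fun x : ℝ ↦ x) (𝓝[>] 0) (𝓝 0) := nhdsWithin_le_nhds
  have pl := tendsto_mYield_zero hl.pos
  have pμ := tendsto_mYield_zero hμ.pos
  have ql := tendsto_mForward_zero l
  have qμ := tendsto_mForward_zero μ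
  have h := ((((qμ.const_mul (-l / 2)).sub (pl.const_mul μ)).add ((pl.mul qμ).mul hid)).sub
    (((ql.const_mul (-μ / 2)).sub (pμ.const_mul l)).add ((pμ.mul ql).mul hid)))
  have hk : l * μ * (l - μ) / 6 =
      -l / 2 * μ ^ 2 - μ * (l ^ 2 / 3) + l ^ 2 / 3 * μ ^ 2 * 0 -
        (-μ / 2 * l ^ 2 - l * (μ ^ 2 / 3) + μ ^ 2 / 3 * l ^ 2 * 0) := by ring
  rw [hk]
  refine h.congr' ?_
  filter_upwards [self_mem_nhdsWithin] with x (hx : 0 < x)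
  rw [kernelWronskian_mYield]
  field_simp
  ring

theorem sq_mul_mYield {x μ : ℝ} (hx : 0 < x) (hμ : 0 < μ) :
    x ^ 2 * mYield x μ = (Real.exp (-μ * x) * (1 + μ * x) - 1) / μ := by
  rw [mYield]
  field_simp

theorem tendsto_sq_mul_mYield {μ : ℝ} (hμ : 0 < μ) :
    Tendsto (fun x ↦ x ^ 2 * mYield x μ) atTop (𝓝 (-1 / μ)) := by
  have h1 : Tendsto (fun x : ℝ ↦ μ * x) atTop atTop := tendsto_id.const_mul_atTop hμ
  have h2 := Real.tendsto_exp_neg_atTop_nhds_zero.comp h1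
  have h3 := (Real.tendsto_pow_mul_exp_neg_atTop_nhds_zero 1).comp h1
  have h4 := ((h2.add h3).sub_const 1).div_const μ
  rw [add_zero, zero_sub] at h4
  refine h4.congr' ?_
  filter_upwards [eventually_gt_atTop 0] with x hx
  rw [sq_mul_mYield hx hμ]
  simp only [Function.comp_apply, pow_one, neg_mul]
  ring

/-- In the Wronskian `m_y` decays like `x⁻²` and `m_f` exponentially, with a further division by
`x`; hence the scaling `x³ e^(λ x)` with the slowest rate. Since `m_y` decays only like `x⁻²`, no
exponent outgrows the denominator and the envelope never escapes. -/
theorem exists_tendsto_eta_yield_atTop : ∃ e, Tendsto (p.family .yield).eta atTop (𝓝 e) := by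
  have h0 := p.lam_pos
  have h1 := p.lam_one_pos
  refine exists_tendsto_eta_kernelFamily (σ := fun x ↦ x ^ 3 * Real.exp (p.lam 0 * x))
    (k := fun l μ ↦ -1 / l * p.forwardLimit μ - -1 / μ * p.forwardLimit l)
    ?_ (eventually_gt_atTop 0)
    (fun x hx ↦ by positivity) (fun x hx μ hμ ↦ hasDerivAt_mYield hx hμ) fun l μ hl hμ ↦ ?_
  · rw [forwardLimit_one, forwardLimit_zero, mul_zero, zero_sub, neg_ne_zero]
    exact mul_ne_zero (div_neg_of_neg_of_pos (by norm_num) h1).ne (neg_ne_zero.2 h0.ne')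
  · refine (((tendsto_sq_mul_mYield hl.pos).mul (tendsto_forwardLimit hμ.le)).sub
      ((tendsto_sq_mul_mYield hμ.pos).mul (tendsto_forwardLimit hl.le))).congr' ?_
    filter_upwards [eventually_gt_atTop 0] with x hx
    rw [kernelWronskian_mYield]
    field_simp

theorem limitsAlong_yield_zero : (p.family .yield).LimitsAlong (𝓝[>] 0)
    (p.opConst fun μ ↦ -μ / 2) (-p.lam 0 / 2) (-p.lam 1 / 2) := by
  refine limitsAlong_kernelFamily (k := fun μ ↦ -μ / 2) (fun μ hμ ↦ ?_)
    (by linarith [p.lam_pos])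
  have hid : Tendsto (fun x : ℝ ↦ x) (𝓝[>] 0) (𝓝 0) := nhdsWithin_le_nhds
  have h := ((hid.pow 2).const_add 1).mul (((tendsto_mYield_zero hμ.pos).mul hid).sub_const (μ / 2))
  rw [show (1 + (0 : ℝ) ^ 2) * (μ ^ 2 / 3 * 0 - μ / 2) = -μ / 2 by ring] at h
  refine h.congr' ?_
  filter_upwards [self_mem_nhdsWithin] with x (hx : 0 < x)
  field_simp
  ring

theorem limitsAlong_yield_atTop : (p.family .yield).LimitsAlong atTop
    (p.opConst fun μ ↦ -1 / μ) (-1 / p.lam 0) (-1 / p.lam 1) := by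
  refine limitsAlong_kernelFamily (k := fun μ ↦ -1 / μ) (fun μ hμ ↦ ?_)
    (div_neg_of_neg_of_pos (by norm_num) p.lam_pos)
  have h := tendsto_sq_mul_mYield hμ.pos
  have h2 : Tendsto (fun x : ℝ ↦ (x ^ 2)⁻¹) atTop (𝓝 0) :=
    tendsto_inv_atTop_zero.comp (tendsto_pow_atTop two_ne_zero)
  have h3 := (h2.mul h).add h
  rw [zero_mul, zero_add] at h3
  refine h3.congr' ?_
  filter_upwards [eventually_gt_atTop 0] with x hx
  field_simp

/-- The normals of the limiting lines compare as `0 < λ₂/λ₁` for the forward curve and as `λ₁/λ₂ <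
λ₂/λ₁` for the yield curve. -/
theorem exists_windingNumber_family (k : CurveKind) {z : Plane}
    (hz : z ∉ (p.family k).envelope ∪ (p.family k).line₀ ∪ (p.family k).lineInf) :
    ∃ M : Plane, (p.family k).line₀ ∩ (p.family k).lineInf = {M} ∧ ∃ w : ℤ,
      (∀ w' : ℤ, HasWindingNumber ((p.family k).augmentedEnvelope M) z w' ↔ w' = w) ∧
      {x | 0 < x ∧ (p.family k).F x z = 0}.encard =
        ((2 * w.natAbs +
          ((p.family k).quadrantH ∪ (p.family k).quadrantD).indicator (fun _ ↦ 1) z : ℕ) : ℕ∞) := by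
  have h0 := p.lam_pos
  have h1 := p.lam_one_pos
  have h01 := p.lam_lt
  cases k with
  | forward =>
    refine LineFamily.exists_windingNumber isRegular_forward limitsAlong_forward_zero
      limitsAlong_forward_atTop ?_ exists_tendsto_eta_forward_zero eta_forward_atTop hz
    rw [zero_div, neg_div_neg_eq]
    exact div_pos h1 h0
  | yield =>
    refine LineFamily.exists_windingNumber isRegular_yield limitsAlong_yield_zero
      limitsAlong_yield_atTop ?_ exists_tendsto_eta_yield_zero
      (Or.inl exists_tendsto_eta_yield_atTop) hz
    have e1 : -1 / p.lam 1 / (-1 / p.lam 0) = p.lam 0 / p.lam 1 := by field_simp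
    have e2 : -p.lam 1 / 2 / (-p.lam 0 / 2) = p.lam 1 / p.lam 0 := by field_simp
    rw [e1, e2, div_lt_div_iff₀ h1 h0]
    nlinarith

end Params

/-! ### The integrated Ornstein–Uhlenbeck path and its approximation by sums. -/

/-- The integral of the solution of `ζ(t) = z - ∫₀ᵗ l (ζ - θ) ds + σ β(t)`. -/
theorem integral_ornsteinUhlenbeck {ζ β : ℝ → ℝ} (hζ : Continuous ζ) (hβ : Continuous β)
    {l θ σ z : ℝ} (hl : l ≠ 0)
    (h : ∀ t, 0 ≤ t → ζ t = z + (∫ s in (0 : ℝ)..t, -l * (ζ s - θ)) + σ * β t) {x : ℝ}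
    (hx : 0 ≤ x) :
    ∫ s in (0 : ℝ)..x, ζ s = θ * x + (z - θ) * ((1 - Real.exp (-l * x)) / l) +
      σ * ∫ s in (0 : ℝ)..x, Real.exp (-l * (x - s)) * β s := by
  set I : ℝ → ℝ := fun t ↦ ∫ s in (0 : ℝ)..t, ζ s with hI
  have hIder : ∀ t, HasDerivAt I (ζ t) t := fun t ↦
    intervalIntegral.integral_hasDerivAt_right (hζ.intervalIntegrable _ _)
      (hζ.stronglyMeasurableAtFilter _ _) hζ.continuousAt
  have hζI : ∀ t, 0 ≤ t → ζ t = z - l * (I t - θ * t) + σ * β t := by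
    intro t ht
    rw [h t ht, intervalIntegral.integral_const_mul,
      intervalIntegral.integral_sub (hζ.intervalIntegrable _ _) intervalIntegrable_const,
      intervalIntegral.integral_const]
    simp only [hI, smul_eq_mul]
    ring
  -- The equation is a pathwise linear differential equation for the integral `I`, solved with the
  -- integrating factor `e^(l t)`; no stochastic integral is needed.
  have hder : ∀ t ∈ Set.uIcc 0 x, HasDerivAt
      (fun t ↦ Real.exp (l * t) * (I t - (θ * t + (z - θ) / l)))
      (σ * (Real.exp (l * t) * β t)) t := by
    intro t ht
    rw [Set.uIcc_of_le hx] at ht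
    have h1 := ((hasDerivAt_id t).const_mul l).exp
    have h2 := (hIder t).sub (((hasDerivAt_id t).const_mul θ).add_const ((z - θ) / l))
    refine (h1.mul h2).congr_deriv ?_
    simp only [id, hζI t ht.1, Pi.sub_apply]
    field_simp
    ring
  have hint := intervalIntegral.integral_eq_sub_of_hasDerivAt hder
    ((by fun_prop : Continuous fun t ↦ σ * (Real.exp (l * t) * β t)).intervalIntegrable _ _)
  rw [intervalIntegral.integral_const_mul] at hint
  have hker : ∀ s, Real.exp (-l * (x - s)) * β s =
      Real.exp (-l * x) * (Real.exp (l * s) * β s) := by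
    intro s
    rw [← mul_assoc, ← Real.exp_add]
    ring_nf
  have hI0 : I 0 = 0 := by simp [hI]
  have he : Real.exp (-l * x) * Real.exp (l * x) = 1 := by
    rw [← Real.exp_add]; simp
  simp_rw [hker]
  rw [intervalIntegral.integral_const_mul, mul_left_comm, hint, hI0]
  simp only [mul_zero, Real.exp_zero]
  linear_combination (-(I x - (θ * x + (z - θ) / l))) * he

/-- Riemann sums with arbitrary tags, with respect to the density `g`. -/
theorem tendsto_sum_mul_integral {f g : ℝ → ℝ} (hf : Continuous f) (hg : Continuous g) {x : ℝ}
    (hx : 0 ≤ x) {τ : ℕ → ℕ → ℝ}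
    (hτ : ∀ n k : ℕ, k < n → τ n k ∈ Set.Icc (k * x / n) (((k + 1 : ℕ) : ℝ) * x / n)) :
    Tendsto (fun n : ℕ ↦ ∑ k ∈ Finset.range n,
      f (τ n k) * ∫ s in (k * x / n : ℝ)..(((k + 1 : ℕ) : ℝ) * x / n), g s) atTop
      (𝓝 (∫ s in (0 : ℝ)..x, f s * g s)) := by
  obtain ⟨C, hC⟩ := isCompact_Icc.exists_bound_of_continuousOn (hg.continuousOn (s := Set.Icc 0 x))
  have hC0 : 0 ≤ C := (norm_nonneg _).trans (hC 0 ⟨le_rfl, hx⟩)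
  have huc : UniformContinuousOn f (Set.Icc 0 x) :=
    isCompact_Icc.uniformContinuousOn_of_continuous hf.continuousOn
  rw [Metric.tendsto_atTop]
  intro ε hε
  have hfg : Continuous fun s ↦ f s * g s := hf.mul hg
  -- The total error is at most this number times `C * x`, hence below `ε`; the `1` covers `C * x =
  -- 0`.
  have hη : 0 < ε / (C * x + 1) := by positivity
  obtain ⟨δ, hδ, hfδ⟩ := Metric.uniformContinuousOn_iff.1 huc _ hη
  obtain ⟨N, hN⟩ := exists_nat_gt (x / δ)
  refine ⟨N + 1, fun n hn ↦ ?_⟩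
  have hn0 : (0 : ℝ) < n := by
    have : 0 < n := by omega
    exact_mod_cast this
  have hmesh : x / n < δ := by
    rw [div_lt_comm₀ hn0 hδ]
    have : (N : ℝ) ≤ n := by exact_mod_cast (by omega : N ≤ n)
    linarith
  have hle : ∀ k : ℕ, (k * x / n : ℝ) ≤ ((k + 1 : ℕ) : ℝ) * x / n := fun k ↦ by
    gcongr
    omega
  have hsplit : ∫ s in (0 : ℝ)..x, f s * g s = ∑ k ∈ Finset.range n,
      ∫ s in (k * x / n : ℝ)..(((k + 1 : ℕ) : ℝ) * x / n), f s * g s := by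
    rw [intervalIntegral.sum_integral_adjacent_intervals (a := fun k : ℕ ↦ (k * x / n : ℝ))
      fun k _ ↦ hfg.intervalIntegrable _ _]
    have : (n * x / n : ℝ) = x := by field_simp
    rw [this]
    simp
  rw [dist_eq_norm, hsplit, ← Finset.sum_sub_distrib]
  calc ‖∑ k ∈ Finset.range n, (f (τ n k) * (∫ s in (k * x / n : ℝ)..(((k + 1 : ℕ) : ℝ) * x / n), g s) -
        ∫ s in (k * x / n : ℝ)..(((k + 1 : ℕ) : ℝ) * x / n), f s * g s)‖
      ≤ ∑ k ∈ Finset.range n, ε / (C * x + 1) * C * (x / n) := by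
        refine norm_sum_le_of_le _ fun k hk ↦ ?_
        have hkn : k < n := Finset.mem_range.1 hk
        have hsub : ∀ s ∈ Set.Icc (k * x / n : ℝ) (((k + 1 : ℕ) : ℝ) * x / n), s ∈ Set.Icc 0 x := by
          intro s hs
          refine ⟨le_trans (by positivity) hs.1, hs.2.trans ?_⟩
          rw [div_le_iff₀ hn0, mul_comm x]
          have : ((k + 1 : ℕ) : ℝ) ≤ n := by exact_mod_cast hkn
          gcongr
        rw [← intervalIntegral.integral_const_mul, ← intervalIntegral.integral_sub
          ((hg.intervalIntegrable _ _).const_mul _) (hfg.intervalIntegrable _ _)]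
        refine (intervalIntegral.norm_integral_le_of_norm_le_const
          (C := ε / (C * x + 1) * C) fun s hs ↦ ?_).trans (le_of_eq ?_)
        · rw [Set.uIoc_of_le (hle k)] at hs
          have hs' := Set.Ioc_subset_Icc_self hs
          rw [← sub_mul, norm_mul]
          refine mul_le_mul ?_ (hC s (hsub s hs')) (norm_nonneg _) hη.le
          rw [← dist_eq_norm]
          refine (hfδ _ (hsub _ (hτ n k hkn)) _ (hsub s hs') ?_).le
          refine lt_of_le_of_lt (Real.dist_le_of_mem_Icc (hτ n k hkn) hs') ?_
          calc ((k + 1 : ℕ) : ℝ) * x / n - k * x / n = x / n := by push_cast; ring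
            _ < δ := hmesh
        · rw [abs_of_nonneg (sub_nonneg.2 (hle k))]
          push_cast
          ring
    _ = ε * (C * x / (C * x + 1)) := by
        rw [Finset.sum_const, Finset.card_range, nsmul_eq_mul]
        field_simp
    _ < ε * 1 := by
        refine mul_lt_mul_of_pos_left ?_ hε
        rw [div_lt_one (by positivity)]
        linarith
    _ = ε := mul_one ε

/-- Summation by parts. -/
theorem sum_mul_sub_eq (K β : ℕ → ℝ) (n : ℕ) :
    ∑ k ∈ Finset.range n, K (k + 1) * (β (k + 1) - β k) =
      K n * β n - K 0 * β 0 - ∑ k ∈ Finset.range n, β k * (K (k + 1) - K k) := by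
  induction n with
  | zero => simp
  | succ n ih =>
    rw [Finset.sum_range_succ, Finset.sum_range_succ, ih]
    ring

/-- Approximation of `∫ k β ds` by sums of increments of `β`, where `K' = -k` and `K(x) = 0`. -/
theorem tendsto_sum_increments {K k β : ℝ → ℝ} (hβ : Continuous β) (hk : Continuous k)
    (hK : ∀ t, HasDerivAt K (-k t) t) (hβ0 : β 0 = 0) {x : ℝ} (hKx : K x = 0) (hx : 0 ≤ x) :
    Tendsto (fun n : ℕ ↦ ∑ j ∈ Finset.range n, K (((j + 1 : ℕ) : ℝ) * x / n) *
      (β (((j + 1 : ℕ) : ℝ) * x / n) - β (j * x / n))) atTop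
      (𝓝 (∫ s in (0 : ℝ)..x, k s * β s)) := by
  -- Summation by parts evaluates `β` at left end points.
  have h := tendsto_sum_mul_integral hβ hk hx (τ := fun n j ↦ j * x / n) fun n j _ ↦
    ⟨le_rfl, by gcongr; omega⟩
  simp_rw [mul_comm (k _)]
  refine h.congr' ?_
  filter_upwards [eventually_gt_atTop 0] with n hn
  have hn0 : (n : ℝ) ≠ 0 := by positivity
  rw [sum_mul_sub_eq (fun j : ℕ ↦ K (j * x / n)) (fun j : ℕ ↦ β (j * x / n))]
  have h1 : (n * x / n : ℝ) = x := by field_simp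
  -- The boundary terms vanish because `K x = 0` and `β 0 = 0`.
  simp only [h1, hKx, Nat.cast_zero, zero_mul, zero_div, hβ0, mul_zero, sub_zero, zero_sub]
  rw [← Finset.sum_neg_distrib]
  refine Finset.sum_congr rfl fun j _ ↦ ?_
  have h2 := intervalIntegral.integral_eq_sub_of_hasDerivAt (fun t _ ↦ hK t)
    (hk.neg.intervalIntegrable (j * x / n : ℝ) (((j + 1 : ℕ) : ℝ) * x / n))
  rw [intervalIntegral.integral_neg] at h2
  rw [← h2]
  ring

/-! ### The Gaussian law of the integrated short rate. -/

section Gaussian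

variable {Ω : Type*} [MeasurableSpace Ω] {Q : Measure Ω} [IsProbabilityMeasure Q]

/-- An almost sure limit of centred Gaussian random variables is Gaussian. -/
theorem map_eq_gaussianReal_of_tendsto {S : ℕ → Ω → ℝ} {G : Ω → ℝ} {V : ℝ}
    (hS : ∀ n, HasGaussianLaw (S n) Q) (hmean : ∀ n, Q[S n] = 0)
    (hvar : Tendsto (fun n ↦ Var[S n; Q]) atTop (𝓝 V))
    (hlim : ∀ᵐ ω ∂Q, Tendsto (fun n ↦ S n ω) atTop (𝓝 (G ω))) :
    0 ≤ V ∧ Q.map G = gaussianReal 0 V.toNNReal := by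
  have hV : 0 ≤ V := ge_of_tendsto' hvar fun n ↦ variance_nonneg _ _
  refine ⟨hV, ?_⟩
  have hSm : ∀ n, AEMeasurable (S n) Q := fun n ↦ (hS n).aemeasurable
  have hGm : AEMeasurable G Q := aemeasurable_of_tendsto_metrizable_ae atTop hSm hlim
  have : IsProbabilityMeasure (Q.map G) := Measure.isProbabilityMeasure_map hGm
  refine Measure.ext_of_charFun ?_
  ext1 t
  have hcont : Continuous fun y : ℝ ↦ Complex.exp (t * y * Complex.I) := by fun_prop
  have hchar : ∀ {Y : Ω → ℝ}, AEMeasurable Y Q →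
      charFun (Q.map Y) t = ∫ ω, Complex.exp (t * Y ω * Complex.I) ∂Q := by
    intro Y hY
    rw [charFun_apply_real, integral_map hY hcont.aestronglyMeasurable]
  -- The characteristic functions converge by dominated convergence; `h2` computes the same limit
  -- from the variances.
  have h1 : Tendsto (fun n ↦ charFun (Q.map (S n)) t) atTop (𝓝 (charFun (Q.map G) t)) := by
    simp_rw [hchar (hSm _), hchar hGm]
    refine tendsto_integral_of_dominated_convergence (fun _ ↦ 1)
      (fun n ↦ (hcont.comp_aestronglyMeasurable (hSm n).aestronglyMeasurable))
      (integrable_const 1) (fun n ↦ Eventually.of_forall fun ω ↦ ?_) ?_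
    · rw [← Complex.ofReal_mul, Complex.norm_exp_ofReal_mul_I]
    · filter_upwards [hlim] with ω hω
      exact (hcont.tendsto _).comp hω
  have h2 : Tendsto (fun n ↦ charFun (Q.map (S n)) t) atTop
      (𝓝 (charFun (gaussianReal 0 V.toNNReal) t)) := by
    simp_rw [(hS _).map_eq_gaussianReal, hmean, charFun_gaussianReal,
      Real.coe_toNNReal _ (variance_nonneg _ _), Real.coe_toNNReal _ hV]
    have hc : Continuous fun v : ℝ ↦
        Complex.exp (t * (0 : ℝ) * Complex.I - v * (t : ℂ) ^ 2 / 2) := by fun_prop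
    exact (hc.tendsto V).comp hvar
  exact tendsto_nhds_unique h1 h2

end Gaussian

/-- The correlations of the Brownian motions. -/
noncomputable def Params.corr (p : Params) (i j : Fin 2) : ℝ := if i = j then 1 else p.rho

/-- The function `(1 - e^{-λ x}) / λ`. -/
noncomputable def hKernel (x l : ℝ) : ℝ := (1 - Real.exp (-l * x)) / l

theorem hasDerivAt_hKernel {l : ℝ} (hl : l ≠ 0) (x : ℝ) :
    HasDerivAt (fun y ↦ hKernel y l) (Real.exp (-l * x)) x := by
  refine (((((hasDerivAt_id x).const_mul (-l)).exp).const_sub 1).div_const l).congr_deriv ?_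
  simp only [id]
  field_simp

theorem continuous_hKernel (l : ℝ) : Continuous fun y ↦ hKernel y l := by
  unfold hKernel
  fun_prop

namespace IsVasicek

variable {Ω : Type*} [MeasurableSpace Ω] {p : Params} {Q : Measure Ω}
  {z : Plane} {B Z : Fin 2 → ℝ≥0 → Ω → ℝ}

theorem memLp (h : IsVasicek p Q z B Z) (i : Fin 2) (s : ℝ≥0) : MemLp (B i s) 2 Q :=
  ((h.brownian i).hasLaw_eval s).hasGaussianLaw.memLp_two

theorem covariance_eq (h : IsVasicek p Q z B Z) (i j : Fin 2) (s t : ℝ≥0) :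
    cov[B i s, B j t; Q] = p.corr i j * (min s t : ℝ≥0) := by
  rw [Params.corr]
  split_ifs with hij
  · subst hij
    rw [(h.brownian i).covariance_eval]
    simp
  · fin_cases i <;> fin_cases j
    · exact absurd rfl hij
    · exact h.correlation s t
    · rw [covariance_comm, min_comm]
      exact h.correlation t s
    · exact absurd rfl hij

variable [IsProbabilityMeasure Q]

/-- Expanded bilinearly, the four minima cancel unless both increments belong to the same interval.
-/
theorem covariance_increments (h : IsVasicek p Q z B Z) {t : ℕ → ℝ≥0} (ht : Monotone t)
    (i j : Fin 2) (k l : ℕ) :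
    cov[fun ω ↦ B i (t (k + 1)) ω - B i (t k) ω, fun ω ↦ B j (t (l + 1)) ω - B j (t l) ω; Q] =
      if k = l then p.corr i j * (t (k + 1) - t k) else 0 := by
  rw [covariance_fun_sub_fun_sub (h.memLp _ _) (h.memLp _ _) (h.memLp _ _) (h.memLp _ _)]
  simp only [h.covariance_eq]
  rcases lt_trichotomy k l with hkl | rfl | hkl
  · rw [if_neg hkl.ne, min_eq_left (ht (by omega : k + 1 ≤ l + 1)),
      min_eq_left (ht (by omega : k + 1 ≤ l)), min_eq_left (ht (by omega : k ≤ l + 1)),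
      min_eq_left (ht hkl.le)]
    ring
  · rw [if_pos rfl, min_self, min_self, min_eq_left (ht (Nat.le_succ k)),
      min_eq_right (ht (Nat.le_succ k))]
    ring
  · rw [if_neg hkl.ne', min_eq_right (ht (by omega : l + 1 ≤ k + 1)),
      min_eq_right (ht (by omega : l + 1 ≤ k)), min_eq_right (ht (by omega : l ≤ k + 1)),
      min_eq_right (ht hkl.le)]
    ring

/-- A weighted sum of increments of the Brownian motions is a centred Gaussian random variable. -/
theorem weighted_increments (h : IsVasicek p Q z B Z) {t : ℕ → ℝ≥0} (ht : Monotone t)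
    (c : Fin 2 → ℕ → ℝ) (n : ℕ) :
    HasGaussianLaw (fun ω ↦ ∑ q ∈ Finset.univ ×ˢ Finset.range n,
      c q.1 q.2 * (B q.1 (t (q.2 + 1)) ω - B q.1 (t q.2) ω)) Q ∧
    Q[fun ω ↦ ∑ q ∈ Finset.univ ×ˢ Finset.range n,
      c q.1 q.2 * (B q.1 (t (q.2 + 1)) ω - B q.1 (t q.2) ω)] = 0 ∧
    Var[fun ω ↦ ∑ q ∈ Finset.univ ×ˢ Finset.range n,
      c q.1 q.2 * (B q.1 (t (q.2 + 1)) ω - B q.1 (t q.2) ω); Q] =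
      ∑ i, ∑ j, p.corr i j * ∑ k ∈ Finset.range n, c i k * c j k * (t (k + 1) - t k) := by
  have hmem : ∀ q : Fin 2 × ℕ, MemLp (fun ω ↦ B q.1 (t (q.2 + 1)) ω - B q.1 (t q.2) ω) 2 Q :=
    fun q ↦ (h.memLp _ _).sub (h.memLp _ _)
  refine ⟨?_, ?_, ?_⟩
  · classical
    -- The Boolean splits every increment into its two end values with opposite signs, so that the
    -- sum is a linear combination of values of the joint Gaussian process.
    have hsum := ((h.jointly_gaussian.comp_right
      (fun a : Fin 2 × ℕ × Bool ↦ (a.1, t (a.2.1 + if a.2.2 then 1 else 0)))).smul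
        (fun a ↦ if a.2.2 then c a.1 a.2.1 else -c a.1 a.2.1)).hasGaussianLaw_fun_sum
          (I := Finset.univ ×ˢ Finset.range n ×ˢ Finset.univ)
    refine hsum.congr (ae_of_all _ fun ω ↦ ?_)
    simp only [Finset.sum_product, Fintype.sum_bool, Function.comp_apply, smul_eq_mul, if_true,
      Bool.false_eq_true, if_false, add_zero, neg_mul, sub_eq_add_neg, mul_add, mul_neg]
  · rw [integral_finsetSum _ fun q _ ↦ ((hmem q).integrable (by norm_num)).const_mul _]
    refine Finset.sum_eq_zero fun q _ ↦ ?_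
    rw [integral_const_mul, integral_sub ((h.brownian _).integrable_eval _)
      ((h.brownian _).integrable_eval _), (h.brownian _).integral_eval,
      (h.brownian _).integral_eval, sub_zero, mul_zero]
  · rw [variance_fun_sum' fun q _ ↦ (hmem q).const_mul _]
    simp_rw [covariance_const_mul_left, covariance_const_mul_right, h.covariance_increments ht,
      Finset.sum_product]
    refine Finset.sum_congr rfl fun i _ ↦ ?_
    rw [Finset.sum_comm]
    refine Finset.sum_congr rfl fun j _ ↦ ?_
    rw [Finset.mul_sum]
    refine Finset.sum_congr rfl fun k hk ↦ ?_
    simp only [mul_ite, mul_zero, Finset.sum_ite_eq, hk, if_true]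
    ring

/-- The law of the stochastic part of the integrated short rate. -/
theorem map_noise_eq_gaussianReal (h : IsVasicek p Q z B Z) {x : ℝ} (hx : 0 ≤ x) :
    0 ≤ ∑ i, ∑ j, p.corr i j * (p.sig i * p.sig j *
      ∫ s in (0 : ℝ)..x, hKernel (x - s) (p.lam i) * hKernel (x - s) (p.lam j)) ∧
    Q.map (fun ω ↦ ∑ i, p.sig i *
      ∫ s in (0 : ℝ)..x, Real.exp (-p.lam i * (x - s)) * B i s.toNNReal ω) =
    gaussianReal 0 (∑ i, ∑ j, p.corr i j * (p.sig i * p.sig j *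
      ∫ s in (0 : ℝ)..x, hKernel (x - s) (p.lam i) * hKernel (x - s) (p.lam j))).toNNReal := by
  have hlam : ∀ i, p.lam i ≠ 0 := fun i ↦ by
    fin_cases i
    · exact p.lam_pos.ne'
    · exact Params.lam_one_pos.ne'
  let t : ℕ → ℕ → ℝ≥0 := fun n k ↦ (k * x / n : ℝ).toNNReal
  have ht : ∀ n, Monotone (t n) := fun n k l hkl ↦ Real.toNNReal_le_toNNReal (by gcongr)
  have htr : ∀ n k, ((t n k : ℝ≥0) : ℝ) = k * x / n := fun n k ↦
    Real.coe_toNNReal _ (by positivity)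
  -- Integration by parts turns the kernel `e^(-λ(x - s))` against `B ds` into `hKernel (x - s) λ`
  -- against increments of `B`, taken here at right end points.
  let c : ℕ → Fin 2 → ℕ → ℝ := fun n i k ↦
    p.sig i * hKernel (x - ((k + 1 : ℕ) : ℝ) * x / n) (p.lam i)
  have hw := fun n ↦ h.weighted_increments (ht n) (c n) n
  refine map_eq_gaussianReal_of_tendsto (fun n ↦ (hw n).1) (fun n ↦ (hw n).2.1) ?_ ?_
  · simp_rw [(hw _).2.2]
    refine tendsto_finsetSum _ fun i _ ↦ tendsto_finsetSum _ fun j _ ↦ Tendsto.const_mul _ ?_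
    have hc : Continuous fun s : ℝ ↦ p.sig i * p.sig j *
        (hKernel (x - s) (p.lam i) * hKernel (x - s) (p.lam j)) := by
      have h1 := continuous_hKernel (p.lam i)
      have h2 := continuous_hKernel (p.lam j)
      fun_prop
    have hlim := tendsto_sum_mul_integral hc (continuous_const (y := (1 : ℝ))) hx
      (τ := fun n k ↦ ((k + 1 : ℕ) : ℝ) * x / n) fun n k _ ↦
        ⟨by gcongr; exact k.le_succ, le_rfl⟩
    simp_rw [mul_one] at hlim
    rw [intervalIntegral.integral_const_mul] at hlim
    refine hlim.congr fun n ↦ Finset.sum_congr rfl fun k _ ↦ ?_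
    rw [intervalIntegral.integral_const, htr, htr]
    simp only [smul_eq_mul, c]
    ring
  · have hB : ∀ᵐ ω ∂Q, ∀ i, Continuous (fun s ↦ B i s ω) ∧ B i 0 ω = 0 :=
      ae_all_iff.2 fun i ↦ (h.brownian i).cont.and (h.brownian i).eval_zero_ae_eq_zero
    filter_upwards [hB] with ω hω
    simp_rw [Finset.sum_product]
    refine tendsto_finsetSum _ fun i _ ↦ ?_
    have hlim := (tendsto_sum_increments (K := fun s ↦ hKernel (x - s) (p.lam i))
      (k := fun s ↦ Real.exp (-p.lam i * (x - s))) (β := fun s ↦ B i s.toNNReal ω)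
      ((hω i).1.comp continuous_real_toNNReal) (by fun_prop)
      (fun s ↦ by
        have := (hasDerivAt_hKernel (hlam i) (x - s)).comp s ((hasDerivAt_id s).const_sub x)
        refine this.congr_deriv ?_
        ring)
      (by simpa using (hω i).2) (by simp [hKernel]) hx).const_mul (p.sig i)
    refine hlim.congr fun n ↦ ?_
    rw [Finset.mul_sum]
    refine Finset.sum_congr rfl fun k _ ↦ ?_
    simp only [c, t]
    ring

end IsVasicek

/-! ### The bond price and the derivatives of the curves. -/

theorem integral_hKernel_mul {l μ : ℝ} (hl : l ≠ 0) (hμ : μ ≠ 0) (hlμ : l + μ ≠ 0) (x : ℝ) :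
    ∫ s in (0 : ℝ)..x, hKernel (x - s) l * hKernel (x - s) μ =
      (x - hKernel x l - hKernel x μ + hKernel x (l + μ)) / (l * μ) := by
  rw [intervalIntegral.integral_comp_sub_left (fun u ↦ hKernel u l * hKernel u μ), sub_self,
    sub_zero]
  -- Multiplying out the product of kernels leaves exponentials with rates `l`, `μ` and `l + μ`,
  -- each the derivative of an `hKernel`. This is the source of the sums of rates in `opA`.
  have hder : ∀ u ∈ Set.uIcc 0 x, HasDerivAt
      (fun u ↦ (u - hKernel u l - hKernel u μ + hKernel u (l + μ)) / (l * μ))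
      (hKernel u l * hKernel u μ) u := by
    intro u _
    refine (((((hasDerivAt_id u).sub (hasDerivAt_hKernel hl u)).sub
      (hasDerivAt_hKernel hμ u)).add (hasDerivAt_hKernel hlμ u)).div_const (l * μ)).congr_deriv ?_
    rw [hKernel, hKernel, show -(l + μ) * u = -l * u + -μ * u by ring, Real.exp_add]
    field_simp
    ring
  rw [intervalIntegral.integral_eq_sub_of_hasDerivAt hder
    (((continuous_hKernel l).mul (continuous_hKernel μ)).intervalIntegrable _ _)]
  simp [hKernel]

namespace Params

/-- A linear combination of the values of the kernel `m`, as it occurs in `F`. -/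
noncomputable def affineComb (p : Params) (C : ℝ) (m : ℝ → ℝ → ℝ) (z : Plane) (x : ℝ) : ℝ :=
  C + (p.opA m x + m x (p.lam 0) * z 0 + m x (p.lam 1) * z 1)

theorem hasDerivAt_affineComb {p : Params} {m m' : ℝ → ℝ → ℝ} {x : ℝ} (C : ℝ) (z : Plane)
    (h : ∀ μ, 0 < μ → HasDerivAt (fun y ↦ m y μ) (m' x μ) x) :
    HasDerivAt (p.affineComb C m z)
      (p.opA m' x + m' x (p.lam 0) * z 0 + m' x (p.lam 1) * z 1) x :=
  (((hasDerivAt_opA h).add ((h _ p.lam_pos).mul_const (z 0))).add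
    ((h _ lam_one_pos).mul_const (z 1))).const_add C

/-- The limit of the forward curve and of the yield curve at infinity. -/
noncomputable def longRate (p : Params) : ℝ :=
  p.kappa + p.theta 0 + p.theta 1 - (p.sig 0 ^ 2 / p.lam 0 ^ 2 + p.sig 1 ^ 2 / p.lam 1 ^ 2) / 2 - p.r

end Params

namespace IsVasicek

variable {Ω : Type*} [MeasurableSpace Ω] {p : Params} {Q : Measure Ω}
  {z : Plane} {B Z : Fin 2 → ℝ≥0 → Ω → ℝ}

/-- The integrated short rate. -/
theorem integral_shortRate (h : IsVasicek p Q z B Z) {x : ℝ} (hx : 0 ≤ x) :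
    ∀ᵐ ω ∂Q, ∫ s in (0 : ℝ)..x, shortRate p Z s.toNNReal ω =
      (p.kappa * x + ∑ i, (p.theta i * x + (z i - p.theta i) * hKernel x (p.lam i))) +
        ∑ i, p.sig i * ∫ s in (0 : ℝ)..x, Real.exp (-p.lam i * (x - s)) * B i s.toNNReal ω := by
  have hall : ∀ᵐ ω ∂Q, ∀ i, Continuous (fun t ↦ B i t ω) ∧ Continuous (fun t ↦ Z i t ω) ∧
      ∀ t : ℝ≥0, Z i t ω =
        z i + (∫ s in (0 : ℝ)..t, -p.lam i * (Z i s.toNNReal ω - p.theta i)) +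
          p.sig i * B i t ω :=
    ae_all_iff.2 fun i ↦ (h.brownian i).cont.and ((h.continuous_paths i).and (h.sde i))
  filter_upwards [hall] with ω hω
  have hlam : ∀ i, p.lam i ≠ 0 := fun i ↦ by
    fin_cases i
    · exact p.lam_pos.ne'
    · exact Params.lam_one_pos.ne'
  have hc : ∀ i, Continuous fun s : ℝ ↦ Z i s.toNNReal ω := fun i ↦
    (hω i).2.1.comp continuous_real_toNNReal
  have hint : ∀ i, ∫ s in (0 : ℝ)..x, Z i s.toNNReal ω =
      p.theta i * x + (z i - p.theta i) * hKernel x (p.lam i) +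
        p.sig i * ∫ s in (0 : ℝ)..x, Real.exp (-p.lam i * (x - s)) * B i s.toNNReal ω := by
    intro i
    refine integral_ornsteinUhlenbeck (hc i) ((hω i).1.comp continuous_real_toNNReal) (hlam i)
      (fun t ht ↦ ?_) hx
    have := (hω i).2.2 t.toNNReal
    rwa [Real.coe_toNNReal _ ht] at this
  have hc' : Continuous fun s : ℝ ↦ p.kappa + Z 0 s.toNNReal ω := continuous_const.add (hc 0)
  simp only [shortRate]
  rw [intervalIntegral.integral_add (hc'.intervalIntegrable _ _)
    ((hc 1).intervalIntegrable _ _), intervalIntegral.integral_add intervalIntegrable_const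
    ((hc 0).intervalIntegrable _ _), hint 0, hint 1, intervalIntegral.integral_const]
  simp only [Fin.sum_univ_two, smul_eq_mul]
  ring

variable [IsProbabilityMeasure Q]

/-- The Gaussian moment generating function at `-1` gives minus the mean plus half the variance. The
terms linear in `x` form `longRate`, the others `opA hKernel` and the terms in `z`. -/
theorem log_bondPrice (h : IsVasicek p Q z B Z) {x : ℝ} (hx : 0 ≤ x) :
    Real.log (bondPrice p Q Z x) = -p.affineComb (p.longRate * x) hKernel z x := by
  have h0 := p.lam_pos
  have h1 := p.lam_one_pos
  obtain ⟨hV, hlaw⟩ := h.map_noise_eq_gaussianReal hx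
  have hmgf := mgf_gaussianReal hlaw (-1)
  rw [mgf, Real.coe_toNNReal _ hV] at hmgf
  have hprice : bondPrice p Q Z x =
      Real.exp (-(p.kappa * x + ∑ i, (p.theta i * x + (z i - p.theta i) * hKernel x (p.lam i)))) *
      ∫ ω, Real.exp (-1 * ∑ i, p.sig i *
        ∫ s in (0 : ℝ)..x, Real.exp (-p.lam i * (x - s)) * B i s.toNNReal ω) ∂Q := by
    rw [bondPrice, ← integral_const_mul]
    refine integral_congr_ae ?_
    filter_upwards [h.integral_shortRate hx] with ω hω
    rw [hω, ← Real.exp_add]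
    congr 1
    ring
  rw [hprice, hmgf, ← Real.exp_add, Real.log_exp]
  simp only [Fin.sum_univ_two]
  rw [integral_hKernel_mul h0.ne' h0.ne' (by positivity),
    integral_hKernel_mul h0.ne' h1.ne' (by positivity),
    integral_hKernel_mul h1.ne' h0.ne' (by positivity),
    integral_hKernel_mul h1.ne' h1.ne' (by positivity), add_comm (p.lam 1) (p.lam 0),
    ← two_mul, ← two_mul]
  simp only [Params.corr, Params.affineComb, Params.longRate, Params.opA, Params.u, Params.r,
    if_true, zero_ne_one, one_ne_zero, if_false]
  field_simp
  ring

theorem hasDerivAt_affineComb_hKernel (z : Plane) (x : ℝ) :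
    HasDerivAt (fun y ↦ p.affineComb (p.longRate * y) hKernel z y)
      (p.affineComb p.longRate (fun y μ ↦ Real.exp (-μ * y)) z x) x := by
  have h1 := Params.hasDerivAt_affineComb (p := p) (m := hKernel)
    (m' := fun y μ ↦ Real.exp (-μ * y)) (x := x) 0 z fun μ hμ ↦ hasDerivAt_hKernel hμ.ne' x
  refine (((hasDerivAt_id x).const_mul p.longRate).add h1).congr_deriv ?_ |>.congr_of_eventuallyEq ?_
  · simp [Params.affineComb]
  · exact Eventually.of_forall fun y ↦ by simp [Params.affineComb]

/-- The coefficients do not depend on the kernel, so it suffices to differentiate kernels: `m_f` is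
the second derivative of `hKernel`, `m_y` the derivative of `hKernel x μ / x`. The long rate is an
additive constant in both curves. -/
theorem hasDerivAt_curve (h : IsVasicek p Q z B Z) (k : CurveKind) {x : ℝ} (hx : 0 < x) :
    HasDerivAt (curve p k Q Z) ((p.family k).F x z) x := by
  have hlog : ∀ y, 0 < y → Real.log (bondPrice p Q Z y) =
      -p.affineComb (p.longRate * y) hKernel z y := fun y hy ↦ h.log_bondPrice hy.le
  cases k with
  | forward =>
    have h1 := Params.hasDerivAt_affineComb (p := p) (m := fun y μ ↦ Real.exp (-μ * y))
      (m' := Params.mForward) (x := x) p.longRate z fun μ _ ↦ by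
        refine (((hasDerivAt_id x).const_mul (-μ)).exp).congr_deriv ?_
        simp only [id, Params.mForward]
        ring
    refine h1.congr_of_eventuallyEq ?_
    filter_upwards [Ioi_mem_nhds hx] with y hy
    have h2 : HasDerivAt (fun y ↦ Real.log (bondPrice p Q Z y))
        (-p.affineComb p.longRate (fun y μ ↦ Real.exp (-μ * y)) z y) y := by
      refine (hasDerivAt_affineComb_hKernel z y).neg.congr_of_eventuallyEq ?_
      filter_upwards [Ioi_mem_nhds hy] with y' hy' using hlog y' hy'
    rw [curve, forwardCurve, h2.deriv, neg_neg]
  | yield =>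
    have h1 := Params.hasDerivAt_affineComb (p := p) (m := fun y μ ↦ hKernel y μ / y)
      (m' := Params.mYield) (x := x) p.longRate z fun μ hμ ↦ by
        refine ((hasDerivAt_hKernel hμ.ne' x).div (hasDerivAt_id x) hx.ne').congr_deriv ?_
        simp only [id, Params.mYield, hKernel]
        field_simp
        ring
    refine h1.congr_of_eventuallyEq ?_
    filter_upwards [Ioi_mem_nhds hx] with y (hy : 0 < y)
    rw [curve, yieldCurve, hlog y hy]
    simp only [Params.affineComb, Params.opA]
    field_simp

/-- The local extrema of the curve are the zeros of `F(·, z)`. -/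
theorem numLocalExtrema_curve (h : IsVasicek p Q z B Z) (k : CurveKind)
    (hz : z ∉ (p.family k).envelope) :
    numLocalExtrema (curve p k Q Z) = {x | 0 < x ∧ (p.family k).F x z = 0}.encard := by
  rw [numLocalExtrema]
  congr 1
  ext x
  refine and_congr_right fun hx ↦ ⟨fun he ↦ he.hasDerivAt_eq_zero (h.hasDerivAt_curve k hx),
    fun hF ↦ ?_⟩
  have hd := h.hasDerivAt_curve k hx
  have hev : deriv (curve p k Q Z) =ᶠ[𝓝 x] fun y ↦ (p.family k).F y z := by
    filter_upwards [Ioi_mem_nhds hx] with y hy using (h.hasDerivAt_curve k hy).deriv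
  -- A degenerate critical point would put `z` on the envelope, so the second derivative test
  -- applies.
  have hne : deriv (deriv (curve p k Q Z)) x ≠ 0 := fun h0 ↦
    hz ⟨x, hx, hF, hev.deriv_eq ▸ h0⟩
  rcases lt_or_gt_of_ne hne with h2 | h2
  · exact Or.inr (isLocalMax_of_deriv_deriv_neg h2 (hd.deriv.trans hF) hd.continuousAt)
  · exact Or.inl (isLocalMin_of_deriv_deriv_pos h2 (hd.deriv.trans hF) hd.continuousAt)

end IsVasicek

end Vasicek

theorem mainTheorem1 {Ω : Type*} [MeasurableSpace Ω] (p : Vasicek.Params) (k : Vasicek.CurveKind)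
    (Q : Measure Ω) [IsProbabilityMeasure Q] (z : Vasicek.Plane) (B Z : Fin 2 → ℝ≥0 → Ω → ℝ)
    (hZ : Vasicek.IsVasicek p Q z B Z)
    (hz : z ∉ (p.family k).envelope ∪ (p.family k).line₀ ∪ (p.family k).lineInf) :
    ∃ M : Vasicek.Plane, (p.family k).line₀ ∩ (p.family k).lineInf = {M} ∧
      ∃ w : ℤ,
        (∀ w' : ℤ,
          Vasicek.HasWindingNumber ((p.family k).augmentedEnvelope M) z w' ↔ w' = w) ∧
        Vasicek.numLocalExtrema (Vasicek.curve p k Q Z) =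
          ((2 * w.natAbs +
            ((p.family k).quadrantH ∪ (p.family k).quadrantD).indicator (fun _ ↦ 1) z : ℕ) : ℕ∞) := by
  rw [hZ.numLocalExtrema_curve k fun h ↦ hz (Or.inl (Or.inl h))]
  exact Vasicek.Params.exists_windingNumber_family k hz
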